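/- **Setting.** Let $J\ge 0$ be an integer, $\mathcal J=\{0,1,\dots,J\}$, and let $F$ be a probability measure on $\mathbb R^{J+1}$ that is absolutely continuous with respect to Lebesgue measure, has finite means ($\mathbb E_F|\varepsilon_j|<\infty$ for all $j$) and has full support $\mathbb R^{J+1}$. Let $\phi:\mathbb R\to(-\infty,+\infty]$ be a proper, closed (lower semicontinuous) convex function with $\phi\ge 0$, $\phi(1)=0$, $1\in\operatorname{int}(\operatorname{dom}\phi)$, $\phi(0)<\infty$, and $\phi(t)=+\infty$ for $t<0$. Let $\phi^*(s)=\sup_{t\in\mathbb R}\{st-\phi(t)\}$, and assume that $\phi^*$ is strictly convex on its effective domain $\operatorname{dom}\phi^*=\{\phi^*<\infty\}$ and differentiable with $\phi^{*\prime}\ge 0$ in the interior of it. Let $\rho>0$. For probability measures $G\ll F$ put $D_\phi(G\|F)=\mathbb E_F[\phi(dG/dF)]$. Put $H(u,\varepsilon)=\max_{j\in\mathcal J}\{u_j+\varepsilon_j\}$, $$W^{DRO}(u)=\sup\{\mathbb E_G[H(u,\varepsilon)] : G \text{ a probability measure},\ G\ll F,\ D_\phi(G\|F)\le\rho\}\in(-\infty,+\infty],\qquad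 u\in\mathbb R^{J+1},$$ (with $\mathbb E_G[Y]=\mathbb E_G[Y^+]-\mathbb E_G[Y^-]$, taken to be $-\infty$ if $\mathbb E_G[Y^-]=\infty$). Let $\mathcal U=\{u\in\mathbb R^{J+1}:u_0=0\}$ and $$W^{DRO*}(p)=\sup_{u\in\mathcal U}\{\langle p,u\rangle-W^{DRO}(u)\},\qquad p\in\mathbb R^{J+1}.$$ For $u\in\mathcal U$, $\lambda\ge 0$, $\mu\in\mathbb R$ let $$\Psi_p(u,\lambda,\mu)=\lambda\rho+\mu+\lambda\,\mathbb E_F\!\left[\phi^*\!\left(\frac{H(u,\varepsilon)-\mu}{\lambda}\right)\right]-\langle p,u\rangle\in(-\infty,+\infty],$$ where for $\lambda=0$ the third term is read as $\mathbb E_F\big[\sup_{t\in\operatorname{dom}\phi}t\,(H(u,\varepsilon)-\mu)\big]$. An equation $g=\nabla f(x)$ for an extended-real-valued $f$ on $\mathbb R^{J+1}$ means that $f$ is finite near $x$ and differentiable at $x$ with gradient $g$. **Theorem (robust demand inversion).** Let $p\in\Delta_{J+1}=\{p\in\mathbb R^{J+1}:p_j\ge0,\ \sum_jp_j=1\}$.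 Then $\Psi_p$ is strictly convex on $\{(u,\lambda,\mu)\in\mathcal U\times[0,\infty)\times\mathbb R:\Psi_p(u,\lambda,\mu)<\infty\}$, and $$-W^{DRO*}(p)=\inf_{u\in\mathcal U,\ \lambda\ge 0,\ \mu\in\mathbb R}\Psi_p(u,\lambda,\mu).$$ Moreover, for every $u\in\mathcal U$ the following are equivalent: (i) $p=\nabla W^{DRO}(u)$; (ii) $u=\nabla W^{DRO*}(p)$; (iii) there are $\lambda^\star\ge0$ and $\mu^\star\in\mathbb R$ such that $(u,\lambda^\star,\mu^\star)$ is the unique minimizer of $\Psi_p$ over $\mathcal U\times[0,\infty)\times\mathbb R$. -/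

import Mathlib

open MeasureTheory Topology
open scoped ENNReal

noncomputable section

namespace DRORUM

/-- Vectors indexed by the alternatives `0, 1, …, J`, with the Euclidean inner product. -/
abbrev Vec (J : ℕ) : Type := EuclideanSpace ℝ (Fin (J + 1))

/-! ### Extended-real-valued convex analysis -/

/-- The effective domain of an extended-real-valued function. -/
def effDom {X : Type*} (f : X → EReal) : Set X := {x | f x < ⊤}

/-- The convex conjugate `φ*(s) = sup_t (s t - φ t)` of a function on the real line. -/
def conj (φ : ℝ → EReal) (s : ℝ) : EReal := ⨆ t : ℝ, ((s * t : ℝ) : EReal) - φ t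

/-- The extended-real-valued `f` is finite near `x` and has gradient `g` there. -/
def HasGradient {J : ℕ} (f : Vec J → EReal) (g x : Vec J) : Prop :=
  ∃ f' : Vec J → ℝ, (∀ᶠ y in 𝓝 x, f y = (f' y : EReal)) ∧ HasGradientAt f' g x

/-- The expectation `E[Y⁺] - E[Y⁻]` of an extended-real-valued random variable; it is `⊤` when
only `E[Y⁺]` is infinite, and `⊥` as soon as `E[Y⁻]` is infinite. -/
def expect {Ω : Type*} [MeasurableSpace Ω] (P : Measure Ω) (Y : Ω → EReal) : EReal :=
  ((∫⁻ ω, (Y ω).toENNReal ∂P : ℝ≥0∞) : EReal) - ((∫⁻ ω, (-Y ω).toENNReal ∂P : ℝ≥0∞) : EReal)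

/-! ### Divergences -/

/-- The class of divergence functions: proper closed convex functions on the real line, nonnegative,
with minimum `φ 1 = 0` attained in the interior of the effective domain, and `φ 0 < ∞`.
The argument of `φ` is a likelihood ratio, so `φ` is `+∞` on the negative half-line. -/
structure IsDivergenceFunction (φ : ℝ → EReal) : Prop where
  nonneg : ∀ t, 0 ≤ φ t
  closed : LowerSemicontinuous φ
  convex : Convex ℝ {x : ℝ × ℝ | φ x.1 ≤ (x.2 : EReal)}
  one_mem : (1 : ℝ) ∈ interior (effDom φ)
  map_one : φ 1 = 0
  map_zero : φ 0 < ⊤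
  map_neg : ∀ t, t < 0 → φ t = ⊤

/-- The conjugate `φ*` is strictly convex on its effective domain, and differentiable with
nonnegative derivative in the interior of it (which is all of `ℝ` when `φ*` is finite). -/
structure ConjugateRegular (φ : ℝ → EReal) : Prop where
  strictConvex : StrictConvexOn ℝ (effDom (conj φ)) (fun s => (conj φ s).toReal)
  differentiable : ∀ s ∈ interior (effDom (conj φ)),
    DifferentiableAt ℝ (fun s => (conj φ s).toReal) s
  deriv_nonneg : ∀ s ∈ interior (effDom (conj φ)), 0 ≤ deriv (fun s => (conj φ s).toReal) s

open Classical in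
/-- The `φ`-divergence `D_φ(G ‖ F) = E_F[φ(dG/dF)]` if `G ≪ F`, and `∞` otherwise
(the integrand is nonnegative). -/
def divergence {Ω : Type*} [MeasurableSpace Ω] (φ : ℝ → EReal) (G F : Measure Ω) : ℝ≥0∞ :=
  if G ≪ F then ∫⁻ ω, (φ (G.rnDeriv F ω).toReal).toENNReal ∂F else ⊤

/-- The uncertainty set: all probability measures `G ≪ F` with `D_φ(G ‖ F) ≤ ρ`. -/
def uncertaintySet {Ω : Type*} [MeasurableSpace Ω] (φ : ℝ → EReal) (ρ : ℝ) (F : Measure Ω) :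
    Set (Measure Ω) :=
  {G | IsProbabilityMeasure G ∧ G ≪ F ∧ divergence φ G F ≤ ENNReal.ofReal ρ}

/-! ### The random utility model -/

/-- The nominal shock distribution is a probability measure, absolutely continuous with respect to
Lebesgue measure, with finite means and full support. -/
structure IsNominal {J : ℕ} (F : Measure (Vec J)) : Prop where
  prob : IsProbabilityMeasure F
  absCont : F ≪ volume
  finiteMeans : ∀ j, Integrable (fun ε : Vec J => ε j) F
  fullSupport : ∀ O : Set (Vec J), IsOpen O → O.Nonempty → 0 < F O

/-- `H(u, ε) = max_j (u_j + ε_j)`. -/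
def maxUtility {J : ℕ} (u ε : Vec J) : ℝ :=
  Finset.univ.sup' Finset.univ_nonempty (fun j => u j + ε j)

/-- The robust surplus `W^DRO(u) = sup_G E_G[H(u, ε)]`, over the uncertainty set. -/
def surplus {J : ℕ} (φ : ℝ → EReal) (ρ : ℝ) (F : Measure (Vec J)) (u : Vec J) : EReal :=
  ⨆ G ∈ uncertaintySet φ ρ F, expect G (fun ε => (maxUtility u ε : EReal))

/-- Utility vectors normalised by `u_0 = 0`. -/
def normalized (J : ℕ) : Set (Vec J) := {u | u 0 = 0}

/-- `W^DRO*(p) = sup { ⟨p, u⟩ - W^DRO(u) : u_0 = 0 }`, as a function of `p` in `ℝ^(J+1)`. -/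
def surplusConj {J : ℕ} (φ : ℝ → EReal) (ρ : ℝ) (F : Measure (Vec J)) (p : Vec J) : EReal :=
  ⨆ u ∈ normalized J, ((inner ℝ p u : ℝ) : EReal) - surplus φ ρ F u

/-- `λ E_F[φ*((H(u, ε) - μ) / λ)]`. At `λ = 0` the integrand `λ φ*(y / λ) = (λ φ)*(y)` is read as
usual as the conjugate at `y` of the function `0 · φ`, which is zero on the effective domain of `φ`
and `+∞` off it, that is, as the supremum of `t y` over the effective domain of `φ`. -/
def conjTerm {J : ℕ} (φ : ℝ → EReal) (F : Measure (Vec J)) (u : Vec J) (l m : ℝ) : EReal :=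
  if l = 0 then
    expect F (fun ε => ⨆ t ∈ effDom φ, ((t * (maxUtility u ε - m) : ℝ) : EReal))
  else
    (l : EReal) * expect F (fun ε => conj φ ((maxUtility u ε - m) / l))

/-- The objective `λ ρ + μ + λ E_F[φ*((H(u, ε) - μ) / λ)] - ⟨p, u⟩` at the point `(u, λ, μ)`. -/
def objective {J : ℕ} (φ : ℝ → EReal) (ρ : ℝ) (F : Measure (Vec J)) (p : Vec J)
    (x : Vec J × ℝ × ℝ) : EReal :=
  ((x.2.1 * ρ + x.2.2 : ℝ) : EReal) + conjTerm φ F x.1 x.2.1 x.2.2 - ((inner ℝ p x.1 : ℝ) : EReal)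

/-- The feasible points `(u, λ, μ)`: `u_0 = 0` and `λ ≥ 0`. -/
def feasible (J : ℕ) : Set (Vec J × ℝ × ℝ) := {x | x.1 ∈ normalized J ∧ 0 ≤ x.2.1}

/-- `x` is the one and only minimiser of `f` on `S`. -/
def IsUniqueMinimizer {X : Type*} (f : X → EReal) (S : Set X) (x : X) : Prop :=
  x ∈ S ∧ IsMinOn f S x ∧ ∀ y ∈ S, IsMinOn f S y → y = x

end DRORUM

end

/-! Write W for the robust surplus. The basis is Lagrangian duality in the density g = dG/dF: when W
is finite, W(u) is the attained minimum over l ≥ 0 and m of l ρ + m + E_F[(l φ)*(H(u, ε) - m)],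
which is `dualValue`. Working with the conjugate of l φ treats l = 0 and l > 0 alike. Weak duality
(`surplus_le_dualValue`) integrates the Fenchel–Young inequality. For attainment
(`exists_dualValue_le`), a hyperplane separates (ρ, 1, w), for w any real upper bound of W(u), from
the interior of the set of triples reached by bounded densities. It is not vertical, because g = 1
is a Slater point: φ(1) = 0 < ρ and 1 is interior to dom φ. A monotone sequence of bounded densities
then interchanges supremum and expectation. Minimising over u as well gives the formula for -W*(p).

Strict convexity (`dualValue_convex_comb_lt`): the perspective (l, y) ↦ (l φ)*(y) is linear along
rays, but as the shock varies y runs through a whole line, and between two distinct normalised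
points the inequality is strict at some shock. Continuity and full support carry this to the
integral.

When W is finite, each of the three conditions says that u minimises W - ⟨p, ·⟩ among normalised
utilities. For (iii) this is attainment plus strict convexity. For (i), a gradient of a convex
function is a subgradient; conversely (`hasGradientAt_surplusReal`) a subgradient is a gradient once
W(u+h) + W(u-h) - 2W(u) = o(‖h‖), which holds by dominated convergence since ties have probability
zero. For (ii), a unique minimiser forces linear growth of the loss, hence differentiability of W*
at p; conversely, differentiability drives near-maximisers to u. If no dual point has finite value,
then W = ⊤ and W* = ⊥ everywhere, and all three conditions fail. -/

namespace DRORUM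

/-! ### The divergence function on its effective domain -/

/-- The finite values of `φ`. -/
noncomputable def cost (φ : ℝ → EReal) (t : ℝ) : ℝ := (φ t).toReal

section Cost

variable {φ : ℝ → EReal}

lemma mem_effDom_iff {X : Type*} {f : X → EReal} {x : X} : x ∈ effDom f ↔ f x < ⊤ := Iff.rfl

lemma IsDivergenceFunction.coe_cost (hφ : IsDivergenceFunction φ) {t : ℝ} (ht : t ∈ effDom φ) :
    (cost φ t : EReal) = φ t :=
  EReal.coe_toReal (ne_of_lt ht) (ne_of_gt ((EReal.bot_lt_zero).trans_le (hφ.nonneg t)))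

lemma IsDivergenceFunction.cost_nonneg (hφ : IsDivergenceFunction φ) (t : ℝ) : 0 ≤ cost φ t :=
  EReal.toReal_nonneg (hφ.nonneg t)

lemma IsDivergenceFunction.cost_one (hφ : IsDivergenceFunction φ) : cost φ 1 = 0 := by
  simp [cost, hφ.map_one]

lemma IsDivergenceFunction.one_mem_effDom (hφ : IsDivergenceFunction φ) : (1 : ℝ) ∈ effDom φ :=
  interior_subset hφ.one_mem

lemma IsDivergenceFunction.zero_mem_effDom (hφ : IsDivergenceFunction φ) : (0 : ℝ) ∈ effDom φ :=
  hφ.map_zero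

lemma IsDivergenceFunction.nonneg_of_mem (hφ : IsDivergenceFunction φ) {t : ℝ}
    (ht : t ∈ effDom φ) : 0 ≤ t := by
  by_contra h
  have := hφ.map_neg t (not_le.1 h)
  rw [mem_effDom_iff, this] at ht
  exact lt_irrefl _ ht

lemma IsDivergenceFunction.convex_comb (hφ : IsDivergenceFunction φ) {s t a b : ℝ}
    (hs : s ∈ effDom φ) (ht : t ∈ effDom φ) (ha : 0 ≤ a) (hb : 0 ≤ b) (hab : a + b = 1) :
    a * s + b * t ∈ effDom φ ∧ cost φ (a * s + b * t) ≤ a * cost φ s + b * cost φ t := by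
  have h := hφ.convex (x := (s, cost φ s)) (by simp [hφ.coe_cost hs])
    (y := (t, cost φ t)) (by simp [hφ.coe_cost ht]) ha hb hab
  simp only [Prod.smul_mk, smul_eq_mul, Prod.mk_add_mk, Set.mem_ofPred_eq] at h
  have hm : a * s + b * t ∈ effDom φ := lt_of_le_of_lt h (EReal.coe_lt_top _)
  exact ⟨hm, by rwa [← hφ.coe_cost hm, EReal.coe_le_coe_iff] at h⟩

lemma IsDivergenceFunction.measurable (hφ : IsDivergenceFunction φ) : Measurable φ :=
  hφ.closed.measurable

lemma IsDivergenceFunction.measurable_cost (hφ : IsDivergenceFunction φ) :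
    Measurable (cost φ) :=
  measurable_ereal_toReal.comp hφ.measurable

end Cost

/-! ### The conjugate of a multiple of the divergence function -/

/-- The values `t y - l φ t` on the effective domain of `φ`. -/
noncomputable def tilt (φ : ℝ → EReal) (l y : ℝ) (t : effDom φ) : ℝ := t * y - l * cost φ t

/-- The conjugate at `y` of the function `l φ`. -/
noncomputable def scaledConj (φ : ℝ → EReal) (l y : ℝ) : ℝ := ⨆ t : effDom φ, tilt φ l y t

/-- The conjugate of `l φ` is finite everywhere. -/
def ScaledFinite (φ : ℝ → EReal) (l : ℝ) : Prop := ∀ y, BddAbove (Set.range (tilt φ l y))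

lemma iSup_coe_of_bddAbove {ι : Type*} [Nonempty ι] {a : ι → ℝ} (h : BddAbove (Set.range a)) :
    ⨆ i, (a i : EReal) = ((⨆ i, a i : ℝ) : EReal) := by
  refine le_antisymm (iSup_le fun i => EReal.coe_le_coe_iff.2 (le_ciSup h i)) ?_
  refine EReal.le_of_forall_lt_iff_le.1 fun z hz => ?_
  refine EReal.coe_le_coe_iff.2 (ciSup_le fun i => EReal.coe_le_coe_iff.1 ?_)
  exact (le_iSup (fun i => (a i : EReal)) i).trans hz.le

lemma iSup_coe_of_not_bddAbove {ι : Type*} {a : ι → ℝ} (h : ¬ BddAbove (Set.range a)) :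
    ⨆ i, (a i : EReal) = ⊤ := by
  rw [EReal.eq_top_iff_forall_lt]
  intro x
  obtain ⟨_, ⟨i, rfl⟩, hi⟩ := not_bddAbove_iff.1 h x
  exact lt_of_lt_of_le (EReal.coe_lt_coe_iff.2 hi) (le_iSup (fun i => (a i : EReal)) i)

section ScaledConj

variable {φ : ℝ → EReal}

lemma conj_eq_iSup (hφ : IsDivergenceFunction φ) (s : ℝ) :
    conj φ s = ⨆ t : effDom φ, (tilt φ 1 s t : EReal) := by
  refine le_antisymm (iSup_le fun t => ?_) (iSup_le fun t => ?_)
  · by_cases ht : t ∈ effDom φ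
    · refine le_trans (le_of_eq ?_)
        (le_iSup (fun t : effDom φ => (tilt φ 1 s t : EReal)) ⟨t, ht⟩)
      rw [← hφ.coe_cost ht, ← EReal.coe_sub]
      simp [tilt, mul_comm]
    · have : φ t = ⊤ := not_lt_top_iff.1 ht
      simp [this]
  · refine le_trans (le_of_eq ?_)
      (le_iSup (fun t : ℝ => ((s * t : ℝ) : EReal) - φ t) (t : ℝ))
    rw [← hφ.coe_cost t.2, ← EReal.coe_sub]
    simp [tilt, mul_comm]

variable {l l' y y' : ℝ}

lemma tilt_le_scaledConj (h : ScaledFinite φ l) (t : effDom φ) : tilt φ l y t ≤ scaledConj φ l y :=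
  le_ciSup (h y) t

lemma IsDivergenceFunction.nonempty (hφ : IsDivergenceFunction φ) : Nonempty (effDom φ) :=
  ⟨⟨1, hφ.one_mem_effDom⟩⟩

lemma scaledConj_le (hφ : IsDivergenceFunction φ) {c : ℝ} (h : ∀ t, tilt φ l y t ≤ c) :
    scaledConj φ l y ≤ c :=
  have := hφ.nonempty
  ciSup_le h

lemma tilt_mul (c : ℝ) (t : effDom φ) : tilt φ (c * l) (c * y) t = c * tilt φ l y t := by
  unfold tilt; ring

lemma tilt_add (t : effDom φ) : tilt φ (l + l') (y + y') t = tilt φ l y t + tilt φ l' y' t := by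
  unfold tilt; ring

lemma tilt_anti (hφ : IsDivergenceFunction φ) (h : l ≤ l') (t : effDom φ) :
    tilt φ l' y t ≤ tilt φ l y t := by
  have := mul_le_mul_of_nonneg_right h (hφ.cost_nonneg t)
  unfold tilt; linarith

lemma tilt_mono (hφ : IsDivergenceFunction φ) (h : y ≤ y') (t : effDom φ) :
    tilt φ l y t ≤ tilt φ l y' t := by
  have := mul_le_mul_of_nonneg_left h (hφ.nonneg_of_mem t.2)
  unfold tilt; linarith

lemma ScaledFinite.mono (hφ : IsDivergenceFunction φ) (h : ScaledFinite φ l) (hl : l ≤ l') :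
    ScaledFinite φ l' := fun y => by
  obtain ⟨c, hc⟩ := h y
  refine ⟨c, ?_⟩
  rintro _ ⟨t, rfl⟩
  exact (tilt_anti hφ hl t).trans (hc ⟨t, rfl⟩)

lemma ScaledFinite.mul {c : ℝ} (hc : 0 < c) (h : ScaledFinite φ l) : ScaledFinite φ (c * l) :=
  fun y => by
  obtain ⟨d, hd⟩ := h (y / c)
  refine ⟨c * d, ?_⟩
  rintro _ ⟨t, rfl⟩
  have : y = c * (y / c) := by field_simp
  rw [this, tilt_mul]
  exact mul_le_mul_of_nonneg_left (hd ⟨t, rfl⟩) hc.le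

lemma scaledConj_mul (c : ℝ) (hc : 0 ≤ c) (l y : ℝ) :
    scaledConj φ (c * l) (c * y) = c * scaledConj φ l y := by
  simp only [scaledConj, tilt_mul]
  exact (Real.mul_iSup_of_nonneg hc _).symm

/-- Each tilt is linear in the pair `(l, y)`, so the supremum is subadditive; with homogeneity this
gives joint convexity of the perspective. -/
lemma scaledConj_add_le (hφ : IsDivergenceFunction φ) (h : ScaledFinite φ l)
    (h' : ScaledFinite φ l') :
    scaledConj φ (l + l') (y + y') ≤ scaledConj φ l y + scaledConj φ l' y' :=
  scaledConj_le hφ fun t => by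
    rw [tilt_add]
    exact add_le_add (tilt_le_scaledConj h t) (tilt_le_scaledConj h' t)

lemma ScaledFinite.convex_comb (h : ScaledFinite φ l) (h' : ScaledFinite φ l') {a b : ℝ}
    (ha : 0 < a) (hb : 0 < b) : ScaledFinite φ (a * l + b * l') := fun y => by
  obtain ⟨c, hc⟩ := h.mul ha y
  obtain ⟨d, hd⟩ := h'.mul hb 0
  refine ⟨c + d, ?_⟩
  rintro _ ⟨t, rfl⟩
  rw [← add_zero y, tilt_add]
  exact add_le_add (hc ⟨t, rfl⟩) (hd ⟨t, rfl⟩)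

lemma scaledConj_convex_comb (hφ : IsDivergenceFunction φ) (h : ScaledFinite φ l)
    (h' : ScaledFinite φ l') {a b : ℝ} (ha : 0 < a) (hb : 0 < b) :
    scaledConj φ (a * l + b * l') (a * y + b * y') ≤
      a * scaledConj φ l y + b * scaledConj φ l' y' := by
  refine (scaledConj_add_le hφ (h.mul ha) (h'.mul hb)).trans_eq ?_
  rw [scaledConj_mul a ha.le, scaledConj_mul b hb.le]

lemma scaledConj_anti (hφ : IsDivergenceFunction φ) (h : ScaledFinite φ l) (hl : l ≤ l') :
    scaledConj φ l' y ≤ scaledConj φ l y :=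
  scaledConj_le hφ fun t => (tilt_anti hφ hl t).trans (tilt_le_scaledConj h t)

lemma scaledConj_mono (hφ : IsDivergenceFunction φ) (h : ScaledFinite φ l) :
    Monotone (scaledConj φ l) := fun _ _ hy =>
  scaledConj_le hφ fun t => (tilt_mono hφ hy t).trans (tilt_le_scaledConj h t)

/-- The value at `t = 0` does not depend on `y`. Here `φ 0 < ∞` enters: the dual integrand is
bounded below by a constant, so only its positive part can fail to be integrable. -/
lemma neg_le_scaledConj (hφ : IsDivergenceFunction φ) (h : ScaledFinite φ l) (y : ℝ) :
    -(l * cost φ 0) ≤ scaledConj φ l y := by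
  refine le_trans (le_of_eq ?_) (tilt_le_scaledConj h ⟨0, hφ.zero_mem_effDom⟩)
  simp [tilt]

lemma convexOn_scaledConj (hφ : IsDivergenceFunction φ) (h : ScaledFinite φ l) :
    ConvexOn ℝ Set.univ (scaledConj φ l) := by
  rw [convexOn_iff_forall_pos]
  refine ⟨convex_univ, fun x _ y _ a b ha hb hab => ?_⟩
  have := scaledConj_convex_comb hφ h h (y := x) (y' := y) ha hb
  rwa [← add_mul, hab, one_mul] at this

lemma continuous_scaledConj (hφ : IsDivergenceFunction φ) (h : ScaledFinite φ l) :
    Continuous (scaledConj φ l) :=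
  continuousOn_univ.1 ((convexOn_scaledConj hφ h).continuousOn isOpen_univ)

/-- The conjugate of `0 · φ` is proportional to the positive part. -/
lemma scaledConj_zero_left (hφ : IsDivergenceFunction φ) (h : ScaledFinite φ 0) :
    ∃ β, 1 ≤ β ∧ ∀ y, scaledConj φ 0 y = β * max y 0 := by
  -- This constant is the supremum of the effective domain, which contains `1`.
  refine ⟨scaledConj φ 0 1, ?_, fun y => ?_⟩
  · refine le_trans (le_of_eq ?_) (tilt_le_scaledConj h ⟨1, hφ.one_mem_effDom⟩)
    simp [tilt]
  · rcases le_or_gt 0 y with hy | hy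
    · have := scaledConj_mul (φ := φ) y hy 0 1
      rw [mul_zero, mul_one] at this
      rw [this, max_eq_left hy, mul_comm]
    · rw [max_eq_right hy.le, mul_zero]
      refine le_antisymm (scaledConj_le hφ fun t => ?_) ?_
      · have := mul_nonneg (hφ.nonneg_of_mem t.2) (neg_nonneg.2 hy.le)
        simp only [tilt]; linarith
      · simpa using neg_le_scaledConj hφ h y

lemma conj_eq_coe (hφ : IsDivergenceFunction φ) (h : ScaledFinite φ 1) (s : ℝ) :
    conj φ s = (scaledConj φ 1 s : EReal) := by
  have := hφ.nonempty
  rw [conj_eq_iSup hφ, iSup_coe_of_bddAbove (h s)]; rfl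

lemma scaledFinite_one_of_pos (hl : 0 < l) (h : ScaledFinite φ l) : ScaledFinite φ 1 := by
  have := h.mul (inv_pos.2 hl)
  rwa [inv_mul_cancel₀ hl.ne'] at this

lemma scaledConj_eq_mul_div (hl : 0 < l) (y : ℝ) :
    scaledConj φ l y = l * scaledConj φ 1 (y / l) := by
  rw [← scaledConj_mul l hl.le, mul_one, mul_div_cancel₀ _ hl.ne']

/-! ### Consequences of the regularity of the conjugate -/

lemma ConjugateRegular.strictConvexOn_scaledConj (hφ : IsDivergenceFunction φ)
    (hφ' : ConjugateRegular φ) (h : ScaledFinite φ 1) :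
    StrictConvexOn ℝ Set.univ (scaledConj φ 1) := by
  have hd : effDom (conj φ) = Set.univ := Set.eq_univ_of_forall fun s => by
    rw [effDom, Set.mem_ofPred_eq, conj_eq_coe hφ h]; exact EReal.coe_lt_top _
  have := hφ'.strictConvex
  rw [hd] at this
  simpa only [conj_eq_coe hφ h, EReal.toReal_coe] using this

lemma ConjugateRegular.differentiable_scaledConj (hφ : IsDivergenceFunction φ)
    (hφ' : ConjugateRegular φ) (hl : 0 < l) (h : ScaledFinite φ l) :
    Differentiable ℝ (scaledConj φ l) := by
  have h1 := scaledFinite_one_of_pos hl h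
  have hd : effDom (conj φ) = Set.univ := Set.eq_univ_of_forall fun s => by
    rw [effDom, Set.mem_ofPred_eq, conj_eq_coe hφ h1]; exact EReal.coe_lt_top _
  have h2 : Differentiable ℝ (scaledConj φ 1) := fun s => by
    have := hφ'.differentiable s (by simp [hd])
    simpa only [conj_eq_coe hφ h1, EReal.toReal_coe] using this
  have : scaledConj φ l = fun y => l * scaledConj φ 1 (y / l) :=
    funext fun y => scaledConj_eq_mul_div hl y
  rw [this]
  exact (h2.comp (differentiable_id.div_const l)).const_mul l

/-- Equal values at `x < y` would, by strict convexity, put the midpoint value below the value at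
`x`, against monotonicity. -/
lemma ConjugateRegular.strictMono_scaledConj (hφ : IsDivergenceFunction φ)
    (hφ' : ConjugateRegular φ) (h : ScaledFinite φ 1) : StrictMono (scaledConj φ 1) := by
  have hs := hφ'.strictConvexOn_scaledConj hφ h
  intro x y hxy
  refine lt_of_le_of_ne (scaledConj_mono hφ h hxy.le) fun he => ?_
  have h1 := hs.2 (Set.mem_univ x) (Set.mem_univ y) hxy.ne
    (show (0 : ℝ) < 1 / 2 by norm_num) (show (0 : ℝ) < 1 / 2 by norm_num) (by norm_num)
  have h2 := scaledConj_mono hφ h (a := x) (b := (1 / 2 : ℝ) • x + (1 / 2 : ℝ) • y)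
    (by simp only [smul_eq_mul]; linarith)
  rw [← he] at h1
  simp only [smul_eq_mul] at h1 h2
  linarith

/-- Dividing by `a l₁ + b l₂` turns the combination of pairs into a convex combination of the ratios
`y₁ / l₁` and `y₂ / l₂`, where strict convexity of the conjugate itself applies. -/
lemma ConjugateRegular.scaledConj_strict (hφ : IsDivergenceFunction φ)
    (hφ' : ConjugateRegular φ) (h1 : ScaledFinite φ 1) {l₁ l₂ y₁ y₂ a b : ℝ} (hl₁ : 0 < l₁)
    (hl₂ : 0 < l₂) (ha : 0 < a) (hb : 0 < b) (hne : y₁ / l₁ ≠ y₂ / l₂) :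
    scaledConj φ (a * l₁ + b * l₂) (a * y₁ + b * y₂) <
      a * scaledConj φ l₁ y₁ + b * scaledConj φ l₂ y₂ := by
  have hL : 0 < a * l₁ + b * l₂ := by positivity
  have hs := (hφ'.strictConvexOn_scaledConj hφ h1).2 (Set.mem_univ (y₁ / l₁))
    (Set.mem_univ (y₂ / l₂)) hne
    (show 0 < a * l₁ / (a * l₁ + b * l₂) by positivity)
    (show 0 < b * l₂ / (a * l₁ + b * l₂) by positivity) (by field_simp)
  have he : (a * l₁ / (a * l₁ + b * l₂)) • (y₁ / l₁) + (b * l₂ / (a * l₁ + b * l₂)) • (y₂ / l₂)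
      = (a * y₁ + b * y₂) / (a * l₁ + b * l₂) := by
    simp only [smul_eq_mul]; field_simp
  rw [he] at hs
  rw [scaledConj_eq_mul_div hL, scaledConj_eq_mul_div hl₁, scaledConj_eq_mul_div hl₂]
  refine (mul_lt_mul_of_pos_left hs hL).trans_eq ?_
  simp only [smul_eq_mul]; field_simp

lemma ConjugateRegular.exists_scaledConj_strict_of_zero (hφ : IsDivergenceFunction φ)
    (hφ' : ConjugateRegular φ) (h0 : ScaledFinite φ 0) {l c₁ c₂ a b : ℝ} (hl : 0 < l)
    (ha : 0 < a) (hb : 0 < b) :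
    ∃ s, scaledConj φ (b * l) (a * (c₁ + s) + b * (c₂ + s)) <
      a * scaledConj φ 0 (c₁ + s) + b * scaledConj φ l (c₂ + s) := by
  obtain ⟨β, -, hβ⟩ := scaledConj_zero_left hφ h0
  -- With this shift `c₁ + s = -1`, where the conjugate of `0 · φ` vanishes. The two remaining
  -- arguments differ by `a / (b l)`, so strict monotonicity suffices.
  refine ⟨-c₁ - 1, ?_⟩
  have hm := hφ'.strictMono_scaledConj hφ (h0.mono hφ zero_le_one)
  have hbl : 0 < b * l := by positivity
  rw [hβ, scaledConj_eq_mul_div hbl, scaledConj_eq_mul_div hl,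
    max_eq_right (by linarith : c₁ + (-c₁ - 1) ≤ 0), mul_zero, mul_zero, zero_add, ← mul_assoc]
  refine mul_lt_mul_of_pos_left (hm ?_) hbl
  rw [div_lt_div_iff₀ hbl hl]
  have : 0 < a * l := by positivity
  nlinarith

/-- Along parallel lines the perspective `(l, y) ↦ (l φ)* y` is strictly convex somewhere. -/
lemma ConjugateRegular.exists_scaledConj_strict (hφ : IsDivergenceFunction φ)
    (hφ' : ConjugateRegular φ) {l₁ l₂ c₁ c₂ a b : ℝ} (hl₁ : 0 ≤ l₁) (hl₂ : 0 ≤ l₂)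
    (h₁ : ScaledFinite φ l₁) (h₂ : ScaledFinite φ l₂) (ha : 0 < a) (hb : 0 < b) (hab : a + b = 1)
    (hne : (l₁, c₁) ≠ (l₂, c₂)) :
    ∃ s, scaledConj φ (a * l₁ + b * l₂) (a * (c₁ + s) + b * (c₂ + s)) <
      a * scaledConj φ l₁ (c₁ + s) + b * scaledConj φ l₂ (c₂ + s) := by
  rcases hl₁.eq_or_lt with rfl | hl₁
  · rcases hl₂.eq_or_lt with rfl | hl₂
    · obtain ⟨β, hβ1, hβ⟩ := scaledConj_zero_left hφ h₁
      have hc : c₁ ≠ c₂ := fun h => hne (by rw [h])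
      -- The shift puts the two points symmetrically on opposite sides of the kink at `0`.
      refine ⟨-((c₁ + c₂) / 2), ?_⟩
      simp only [mul_zero, add_zero, hβ]
      have hβ0 : 0 < β := by linarith
      suffices h : max (a * (c₁ + -((c₁ + c₂) / 2)) + b * (c₂ + -((c₁ + c₂) / 2))) 0 <
          a * max (c₁ + -((c₁ + c₂) / 2)) 0 + b * max (c₂ + -((c₁ + c₂) / 2)) 0 by
        nlinarith [mul_lt_mul_of_pos_left h hβ0]
      rcases hc.lt_or_gt with h | h
      · rw [max_eq_right (by linarith : c₁ + -((c₁ + c₂) / 2) ≤ 0),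
          max_eq_left (by linarith : 0 ≤ c₂ + -((c₁ + c₂) / 2)), mul_zero, zero_add]
        refine max_lt ?_ (mul_pos hb (by linarith))
        have : a * (c₁ + -((c₁ + c₂) / 2)) < 0 := mul_neg_of_pos_of_neg ha (by linarith)
        linarith
      · rw [max_eq_right (by linarith : c₂ + -((c₁ + c₂) / 2) ≤ 0),
          max_eq_left (by linarith : 0 ≤ c₁ + -((c₁ + c₂) / 2)), mul_zero, add_zero]
        refine max_lt ?_ (mul_pos ha (by linarith))
        have : b * (c₂ + -((c₁ + c₂) / 2)) < 0 := mul_neg_of_pos_of_neg hb (by linarith)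
        linarith
    · simpa using hφ'.exists_scaledConj_strict_of_zero hφ h₁ hl₂ ha hb
  · rcases hl₂.eq_or_lt with rfl | hl₂
    · obtain ⟨s, hs⟩ := hφ'.exists_scaledConj_strict_of_zero hφ h₂ (c₁ := c₂) (c₂ := c₁) hl₁ hb ha
      refine ⟨s, ?_⟩
      rw [mul_zero, add_zero, add_comm (a * (c₁ + s)), add_comm (a * scaledConj φ l₁ (c₁ + s))]
      exact hs
    · have h1 := scaledFinite_one_of_pos hl₁ h₁
      suffices h : ∃ s, (c₁ + s) / l₁ ≠ (c₂ + s) / l₂ by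
        obtain ⟨s, hs⟩ := h
        exact ⟨s, hφ'.scaledConj_strict hφ h1 hl₁ hl₂ ha hb hs⟩
      -- Otherwise two affine functions of `s` coincide; their values at `0` and `1` force equal
      -- slopes, then equal intercepts.
      by_contra! hall
      have e0 := hall 0
      have e1 := hall 1
      rw [div_eq_div_iff hl₁.ne' hl₂.ne'] at e0 e1
      have hll : l₁ = l₂ := by linarith
      subst hll
      have hcc : c₁ = c₂ := by
        have := mul_right_cancel₀ hl₁.ne' e0
        linarith
      exact hne (by rw [hcc])

end ScaledConj

/-! ### Expectations of real random variables -/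

section Expect

variable {Ω : Type*} [MeasurableSpace Ω] {P : Measure Ω}

lemma expect_coe_of_integrable {Y : Ω → ℝ} (hY : Integrable Y P) :
    expect P (fun ω => (Y ω : EReal)) = ((∫ ω, Y ω ∂P : ℝ) : EReal) := by
  have h1 : ∫⁻ ω, ENNReal.ofReal (Y ω) ∂P ≠ ⊤ := hY.lintegral_lt_top.ne
  have h2 : ∫⁻ ω, ENNReal.ofReal (-Y ω) ∂P ≠ ⊤ := hY.neg.lintegral_lt_top.ne
  rw [integral_eq_lintegral_pos_part_sub_lintegral_neg_part hY, EReal.coe_sub,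
    EReal.coe_ennreal_toReal h1, EReal.coe_ennreal_toReal h2]
  simp only [expect, ← EReal.coe_neg, EReal.real_coe_toENNReal]

/-- The expectation is `⊤` when only the positive part has infinite integral. -/
lemma expect_eq_top_of_le [IsFiniteMeasure P] {Y : Ω → EReal} {c : ℝ}
    (hc : ∀ ω, ((-c : ℝ) : EReal) ≤ Y ω) (h : ∫⁻ ω, (Y ω).toENNReal ∂P = ⊤) :
    expect P Y = ⊤ := by
  have h2 : ∫⁻ ω, (-Y ω).toENNReal ∂P ≠ ⊤ := by
    refine ne_top_of_le_ne_top ?_ (lintegral_mono (g := fun _ => ENNReal.ofReal c) fun ω => ?_)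
    · rw [lintegral_const]
      exact ENNReal.mul_ne_top ENNReal.ofReal_ne_top (measure_ne_top _ _)
    · rw [← EReal.real_coe_toENNReal]
      refine EReal.toENNReal_le_toENNReal ?_
      rw [EReal.neg_le, ← EReal.coe_neg]
      exact hc ω
  rw [expect, h, ← EReal.coe_ennreal_toReal h2]
  simp

lemma expect_coe_of_not_integrable [IsFiniteMeasure P] {Y : Ω → ℝ} {c : ℝ}
    (hm : AEStronglyMeasurable Y P) (hc : ∀ ω, -c ≤ Y ω) (hY : ¬ Integrable Y P) :
    expect P (fun ω => (Y ω : EReal)) = ⊤ := by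
  refine expect_eq_top_of_le (c := c) (fun ω => EReal.coe_le_coe_iff.2 (hc ω)) ?_
  by_contra h
  refine hY ?_
  have h1 : Integrable (fun ω => max (Y ω) 0) P := by
    refine ⟨(hm.sup aestronglyMeasurable_const), ?_⟩
    rw [hasFiniteIntegral_iff_ofReal (f := fun ω => max (Y ω) 0)
      (Filter.Eventually.of_forall fun ω => le_max_right _ _)]
    refine lt_of_le_of_lt (lintegral_mono fun ω => ?_) (lt_top_iff_ne_top.2 h)
    simp
  refine (h1.add (integrable_const |c|)).mono' hm (Filter.Eventually.of_forall fun ω => ?_)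
  have h3 := hc ω
  have h4 := le_max_left (Y ω) 0
  have h5 := le_max_right (Y ω) 0
  have h6 := le_abs_self c
  have h7 := abs_nonneg c
  simp only [Pi.add_apply, Real.norm_eq_abs]
  rw [abs_le]; constructor <;> linarith

end Expect

/-! ### The maximum of the utilities -/

section MaxUtility

variable {J : ℕ}

lemma le_maxUtility (u ε : Vec J) (j : Fin (J + 1)) : u j + ε j ≤ maxUtility u ε :=
  Finset.le_sup' (fun j => u j + ε j) (Finset.mem_univ j)

lemma maxUtility_le {u ε : Vec J} {c : ℝ} (h : ∀ j, u j + ε j ≤ c) : maxUtility u ε ≤ c :=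
  Finset.sup'_le _ _ fun j _ => h j

lemma exists_maxUtility_eq (u ε : Vec J) : ∃ j, maxUtility u ε = u j + ε j := by
  obtain ⟨j, -, hj⟩ := Finset.exists_mem_eq_sup' Finset.univ_nonempty
    (fun j : Fin (J + 1) => u j + ε j)
  exact ⟨j, hj⟩

lemma continuous_maxUtility (u : Vec J) : Continuous (maxUtility u) := by
  unfold maxUtility
  exact Continuous.finset_sup'_apply _ fun j _ => by fun_prop

lemma maxUtility_le_add {u v : Vec J} {c : ℝ} (h : ∀ j, v j ≤ u j + c) (ε : Vec J) :
    maxUtility v ε ≤ maxUtility u ε + c :=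
  maxUtility_le fun j => by linarith [h j, le_maxUtility u ε j]

lemma maxUtility_convex_comb (u v ε : Vec J) {a b : ℝ} (ha : 0 ≤ a) (hb : 0 ≤ b)
    (hab : a + b = 1) :
    maxUtility (a • u + b • v) ε ≤ a * maxUtility u ε + b * maxUtility v ε :=
  maxUtility_le fun j => by
    have h1 := mul_le_mul_of_nonneg_left (le_maxUtility u ε j) ha
    have h2 := mul_le_mul_of_nonneg_left (le_maxUtility v ε j) hb
    have h3 : ε j = a * ε j + b * ε j := by rw [← add_mul, hab, one_mul]
    simp only [PiLp.add_apply, PiLp.smul_apply, smul_eq_mul]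
    linarith

lemma abs_apply_le_norm (u : Vec J) (j : Fin (J + 1)) : |u j| ≤ ‖u‖ := by
  simpa using PiLp.norm_apply_le u j

lemma maxUtility_add_le (u h ε : Vec J) : maxUtility (u + h) ε ≤ maxUtility u ε + ‖h‖ :=
  maxUtility_le_add (fun j => by
    have := (le_abs_self _).trans (abs_apply_le_norm h j)
    simpa using this) ε

lemma integrable_maxUtility {F : Measure (Vec J)} (hF : IsNominal F) (u : Vec J) :
    Integrable (maxUtility u) F := by
  have := hF.prob
  have h : Integrable (fun ε : Vec J => ∑ j, |u j + ε j|) F :=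
    integrable_finsetSum _ fun j _ => ((integrable_const _).add (hF.finiteMeans j)).abs
  refine h.mono' (continuous_maxUtility u).aestronglyMeasurable
    (Filter.Eventually.of_forall fun ε => ?_)
  obtain ⟨j, hj⟩ := exists_maxUtility_eq u ε
  rw [hj, Real.norm_eq_abs]
  exact Finset.single_le_sum (f := fun j => |u j + ε j|) (fun i _ => abs_nonneg _)
    (Finset.mem_univ j)

/-- A shock that makes alternative `j` optimal for each of finitely many utility vectors. -/
lemma exists_maxUtility_eq_apply (s : Finset (Vec J)) (j : Fin (J + 1)) (c : ℝ) :
    ∃ ε : Vec J, ∀ u ∈ s, maxUtility u ε = u j + c := by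
  let N : ℝ := ∑ u ∈ s, ‖u‖
  have hN : ∀ u ∈ s, ∀ i, |u i| ≤ N := fun u hu i => (abs_apply_le_norm u i).trans
    (Finset.single_le_sum (f := fun u : Vec J => ‖u‖) (fun _ _ => norm_nonneg _) hu)
  -- The gap `2 N` suffices because `u i - 2 N ≤ -N ≤ u j`.
  refine ⟨WithLp.toLp 2 fun i => if i = j then c else c - 2 * N, fun u hu => ?_⟩
  refine le_antisymm (maxUtility_le fun i => ?_) ?_
  · by_cases hi : i = j
    · simp [hi]
    · have h1 := (abs_le.1 (hN u hu i)).2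
      have h2 := (abs_le.1 (hN u hu j)).1
      simp only [hi, if_false]
      linarith
  · refine le_trans (le_of_eq ?_) (le_maxUtility u _ j)
    simp

end MaxUtility

/-! ### The dual objective as a real function on its effective domain -/

section Dual

variable {J : ℕ} {F : Measure (Vec J)} {φ : ℝ → EReal} {ρ : ℝ}

lemma IsNominal.isOpenPosMeasure (hF : IsNominal F) : F.IsOpenPosMeasure :=
  ⟨fun O hO hne => (hF.fullSupport O hO hne).ne'⟩

/-- The integrand `(l φ)*(H(u, ε) - m)` at the point `(u, l, m)`. -/
noncomputable def dualIntegrand (φ : ℝ → EReal) (x : Vec J × ℝ × ℝ) (ε : Vec J) : ℝ :=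
  scaledConj φ x.2.1 (maxUtility x.1 ε - x.2.2)

/-- The points `(u, l, m)` with `l ≥ 0` at which the objective is finite. -/
def dualDomain (φ : ℝ → EReal) (F : Measure (Vec J)) : Set (Vec J × ℝ × ℝ) :=
  {x | 0 ≤ x.2.1 ∧ ScaledFinite φ x.2.1 ∧ Integrable (dualIntegrand φ x) F}

/-- The objective for `p = 0`, on its effective domain. -/
noncomputable def dualValue (φ : ℝ → EReal) (ρ : ℝ) (F : Measure (Vec J)) (x : Vec J × ℝ × ℝ) : ℝ :=
  x.2.1 * ρ + x.2.2 + ∫ ε, dualIntegrand φ x ε ∂F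

lemma continuous_dualIntegrand (hφ : IsDivergenceFunction φ) {x : Vec J × ℝ × ℝ}
    (h : ScaledFinite φ x.2.1) : Continuous (dualIntegrand φ x) :=
  (continuous_scaledConj hφ h).comp ((continuous_maxUtility x.1).sub continuous_const)

lemma neg_le_dualIntegrand (hφ : IsDivergenceFunction φ) {x : Vec J × ℝ × ℝ}
    (h : ScaledFinite φ x.2.1) (ε : Vec J) : -(x.2.1 * cost φ 0) ≤ dualIntegrand φ x ε :=
  neg_le_scaledConj hφ h _

lemma integrable_dualIntegrand_of_le (hF : IsNominal F) (hφ : IsDivergenceFunction φ)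
    {x : Vec J × ℝ × ℝ} (h : ScaledFinite φ x.2.1) {g : Vec J → ℝ} (hg : Integrable g F)
    (hle : ∀ ε, dualIntegrand φ x ε ≤ g ε) : Integrable (dualIntegrand φ x) F := by
  have := hF.prob
  refine (hg.abs.add (integrable_const |x.2.1 * cost φ 0|)).mono'
    (continuous_dualIntegrand hφ h).aestronglyMeasurable (Filter.Eventually.of_forall fun ε => ?_)
  have h1 := neg_le_dualIntegrand hφ h ε
  have h2 := hle ε
  have h3 := le_abs_self (g ε)
  have h4 := le_abs_self (x.2.1 * cost φ 0)
  have h5 := abs_nonneg (x.2.1 * cost φ 0)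
  have h6 := abs_nonneg (g ε)
  simp only [Pi.add_apply, Real.norm_eq_abs]
  rw [abs_le]; constructor <;> linarith

lemma exists_lt_maxUtility (u : Vec J) (c : ℝ) : ∃ ε, c < maxUtility u ε := by
  obtain ⟨ε, hε⟩ := exists_maxUtility_eq_apply {u} 0 (c - u 0 + 1)
  refine ⟨ε, ?_⟩
  rw [hε u (by simp)]; linarith

/-- If the conjugate of `l φ` is infinite somewhere, then its integral is infinite. -/
lemma lintegral_iSup_tilt_eq_top (hF : IsNominal F) (hφ : IsDivergenceFunction φ) {l : ℝ}
    (h : ¬ ScaledFinite φ l) {Y : Vec J → ℝ} (hY : Continuous Y) (hY' : ∀ c, ∃ ε, c < Y ε) :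
    ∫⁻ ε, (⨆ t : effDom φ, (tilt φ l (Y ε) t : EReal)).toENNReal ∂F = ⊤ := by
  simp only [ScaledFinite, not_forall] at h
  obtain ⟨y, hy⟩ := h
  -- By monotonicity the supremum stays infinite above `y`, and this nonempty open set has positive
  -- mass by full support.
  let O : Set (Vec J) := {ε | y < Y ε}
  have hO : IsOpen O := isOpen_lt continuous_const hY
  have hle : ∫⁻ ε, O.indicator (fun _ => (⊤ : ℝ≥0∞)) ε ∂F ≤
      ∫⁻ ε, (⨆ t : effDom φ, (tilt φ l (Y ε) t : EReal)).toENNReal ∂F := by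
    refine lintegral_mono fun ε => ?_
    by_cases hε : ε ∈ O
    · have : ⨆ t : effDom φ, (tilt φ l (Y ε) t : EReal) = ⊤ := by
        refine top_le_iff.1 ?_
        rw [← iSup_coe_of_not_bddAbove hy]
        exact iSup_mono fun t => EReal.coe_le_coe_iff.2 (tilt_mono hφ (le_of_lt hε) t)
      simp [this]
    · simp [hε]
  rw [lintegral_indicator hO.measurableSet, lintegral_const,
    Measure.restrict_apply_univ, ENNReal.top_mul (hF.fullSupport O hO (hY' y)).ne'] at hle
  exact top_le_iff.1 hle

lemma le_iSup_tilt (hφ : IsDivergenceFunction φ) (l y : ℝ) :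
    ((-(l * cost φ 0) : ℝ) : EReal) ≤ ⨆ t : effDom φ, (tilt φ l y t : EReal) := by
  refine le_trans (le_of_eq ?_)
    (le_iSup (fun t : effDom φ => (tilt φ l y t : EReal)) ⟨0, hφ.zero_mem_effDom⟩)
  simp [tilt]

lemma conjTerm_eq_top_of_not_scaledFinite (hF : IsNominal F) (hφ : IsDivergenceFunction φ) {l : ℝ}
    (hl : 0 ≤ l) (h : ¬ ScaledFinite φ l) (u : Vec J) (m : ℝ) : conjTerm φ F u l m = ⊤ := by
  have := hF.prob
  have hc := continuous_maxUtility u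
  rcases hl.eq_or_lt with rfl | hl
  · have he : ∀ y : ℝ, ⨆ t ∈ effDom φ, ((t * y : ℝ) : EReal) =
        ⨆ t : effDom φ, (tilt φ 0 y t : EReal) := fun y => by
      rw [iSup_subtype']; simp [tilt]
    simp only [conjTerm, if_true, he]
    refine expect_eq_top_of_le (fun ε => le_iSup_tilt hφ _ _)
      (lintegral_iSup_tilt_eq_top hF hφ h (by fun_prop) fun c => ?_)
    obtain ⟨ε, hε⟩ := exists_lt_maxUtility u (c + m)
    exact ⟨ε, by linarith⟩
  · have h1 : ¬ ScaledFinite φ 1 := fun h1 => h (by simpa using h1.mul hl)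
    simp only [conjTerm, hl.ne', if_false, conj_eq_iSup hφ]
    rw [expect_eq_top_of_le (fun ε => le_iSup_tilt hφ _ _)
      (lintegral_iSup_tilt_eq_top hF hφ h1 (by fun_prop) fun c => ?_), EReal.coe_mul_top_of_pos hl]
    obtain ⟨ε, hε⟩ := exists_lt_maxUtility u (c * l + m)
    exact ⟨ε, by rw [lt_div_iff₀ hl]; linarith⟩

lemma conjTerm_eq_mul_expect (hφ : IsDivergenceFunction φ) {l : ℝ} (hl : 0 < l)
    (h : ScaledFinite φ l) (u : Vec J) (m : ℝ) :
    conjTerm φ F u l m = (l : EReal) *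
      expect F (fun ε => ((l⁻¹ * dualIntegrand φ (u, l, m) ε : ℝ) : EReal)) := by
  have h1 := scaledFinite_one_of_pos hl h
  simp only [conjTerm, hl.ne', if_false, conj_eq_coe hφ h1, dualIntegrand,
    scaledConj_eq_mul_div hl, inv_mul_cancel_left₀ hl.ne']

lemma conjTerm_zero_eq_expect (hφ : IsDivergenceFunction φ) (h : ScaledFinite φ 0) (u : Vec J)
    (m : ℝ) :
    conjTerm φ F u 0 m = expect F (fun ε => (dualIntegrand φ (u, 0, m) ε : EReal)) := by
  have hn := hφ.nonempty
  have he : ∀ y : ℝ, ⨆ t ∈ effDom φ, ((t * y : ℝ) : EReal) = (scaledConj φ 0 y : EReal) :=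
    fun y => by
      rw [iSup_subtype', scaledConj, ← iSup_coe_of_bddAbove (h y)]
      simp [tilt]
  simp only [conjTerm, if_true, he, dualIntegrand]

lemma conjTerm_eq_integral (hφ : IsDivergenceFunction φ)
    {x : Vec J × ℝ × ℝ} (hx : x ∈ dualDomain φ F) :
    conjTerm φ F x.1 x.2.1 x.2.2 = ((∫ ε, dualIntegrand φ x ε ∂F : ℝ) : EReal) := by
  obtain ⟨u, l, m⟩ := x
  obtain ⟨hl, hf, hi⟩ := hx
  rcases hl.eq_or_lt with h | hl
  · dsimp only at h; subst h
    rw [conjTerm_zero_eq_expect hφ hf, expect_coe_of_integrable hi]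
  · dsimp only at hl
    rw [conjTerm_eq_mul_expect hφ hl hf, expect_coe_of_integrable (hi.const_mul _),
      integral_const_mul, ← EReal.coe_mul, mul_inv_cancel_left₀ hl.ne']

/-- Outside the domain either the conjugate is infinite with positive probability, or the integrand,
which is bounded below, has a positive part of infinite integral. So `dualDomain` is exactly where
the objective is finite. -/
lemma conjTerm_eq_top (hF : IsNominal F) (hφ : IsDivergenceFunction φ)
    {x : Vec J × ℝ × ℝ} (hl : 0 ≤ x.2.1) (hx : x ∉ dualDomain φ F) :
    conjTerm φ F x.1 x.2.1 x.2.2 = ⊤ := by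
  have := hF.prob
  obtain ⟨u, l, m⟩ := x
  by_cases hf : ScaledFinite φ l
  · have hi : ¬ Integrable (dualIntegrand φ (u, l, m)) F := fun hi => hx ⟨hl, hf, hi⟩
    have hc := continuous_dualIntegrand hφ (x := (u, l, m)) hf
    have hb := neg_le_dualIntegrand hφ (x := (u, l, m)) hf
    rcases hl.eq_or_lt with h | hl
    · dsimp only at h; subst h
      rw [conjTerm_zero_eq_expect hφ hf]
      exact expect_coe_of_not_integrable hc.aestronglyMeasurable hb hi
    · dsimp only at hl
      rw [conjTerm_eq_mul_expect hφ hl hf, expect_coe_of_not_integrable (c := cost φ 0)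
        (hc.const_mul _).aestronglyMeasurable, EReal.coe_mul_top_of_pos hl]
      · intro ε
        rw [inv_mul_eq_div, le_div_iff₀ hl]
        have := hb ε
        dsimp only at this; linarith
      · rwa [integrable_const_mul_iff (inv_ne_zero hl.ne').isUnit]
  · exact conjTerm_eq_top_of_not_scaledFinite hF hφ hl hf u m

lemma objective_eq_coe (hφ : IsDivergenceFunction φ) (p : Vec J)
    {x : Vec J × ℝ × ℝ} (hx : x ∈ dualDomain φ F) :
    objective φ ρ F p x = ((dualValue φ ρ F x - inner ℝ p x.1 : ℝ) : EReal) := by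
  rw [objective, conjTerm_eq_integral hφ hx, dualValue, EReal.coe_sub, ← EReal.coe_add]

lemma objective_eq_top (hF : IsNominal F) (hφ : IsDivergenceFunction φ) (p : Vec J)
    {x : Vec J × ℝ × ℝ} (hl : 0 ≤ x.2.1) (hx : x ∉ dualDomain φ F) :
    objective φ ρ F p x = ⊤ := by
  rw [objective, conjTerm_eq_top hF hφ hl hx, EReal.coe_add_top, EReal.top_sub_coe]

lemma feasible_inter_effDom (hF : IsNominal F) (hφ : IsDivergenceFunction φ) (p : Vec J) :
    feasible J ∩ effDom (objective φ ρ F p) = {x ∈ dualDomain φ F | x.1 ∈ normalized J} := by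
  ext x
  constructor
  · rintro ⟨⟨h1, h2⟩, h3⟩
    refine ⟨?_, h1⟩
    by_contra h
    rw [mem_effDom_iff, objective_eq_top hF hφ p h2 h] at h3
    exact lt_irrefl _ h3
  · rintro ⟨h1, h2⟩
    refine ⟨⟨h2, h1.1⟩, ?_⟩
    rw [mem_effDom_iff, objective_eq_coe hφ p h1]
    exact EReal.coe_lt_top _

/-! ### Convexity of the dual objective -/

/-- The maximum is convex in `u` and the conjugate is monotone; joint convexity of the perspective
does the rest. -/
lemma dualIntegrand_convex_comb_le (hφ : IsDivergenceFunction φ) {x y : Vec J × ℝ × ℝ}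
    (hx : ScaledFinite φ x.2.1) (hy : ScaledFinite φ y.2.1) {a b : ℝ} (ha : 0 < a) (hb : 0 < b)
    (hab : a + b = 1) (ε : Vec J) :
    dualIntegrand φ (a • x + b • y) ε ≤ a * dualIntegrand φ x ε + b * dualIntegrand φ y ε := by
  refine le_trans ?_ (scaledConj_convex_comb hφ hx hy ha hb)
  have hf : ScaledFinite φ (a * x.2.1 + b * y.2.1) := hx.convex_comb hy ha hb
  refine scaledConj_mono hφ hf ?_
  have := maxUtility_convex_comb x.1 y.1 ε ha.le hb.le hab
  simp only [Prod.fst_add, Prod.snd_add, Prod.smul_fst, Prod.smul_snd, smul_eq_mul]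
  linarith

lemma convex_comb_mem_dualDomain (hF : IsNominal F) (hφ : IsDivergenceFunction φ)
    {x y : Vec J × ℝ × ℝ} (hx : x ∈ dualDomain φ F) (hy : y ∈ dualDomain φ F) {a b : ℝ}
    (ha : 0 < a) (hb : 0 < b) (hab : a + b = 1) : a • x + b • y ∈ dualDomain φ F := by
  have hf : ScaledFinite φ (a • x + b • y).2.1 := hx.2.1.convex_comb hy.2.1 ha hb
  refine ⟨?_, hf, ?_⟩
  · have := hx.1
    have := hy.1
    simp only [Prod.fst_add, Prod.snd_add, Prod.smul_fst, Prod.smul_snd, smul_eq_mul]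
    positivity
  · exact integrable_dualIntegrand_of_le hF hφ hf ((hx.2.2.const_mul a).add (hy.2.2.const_mul b))
      (dualIntegrand_convex_comb_le hφ hx.2.1 hy.2.1 ha hb hab)

lemma dualValue_convex_comb_le (hF : IsNominal F) (hφ : IsDivergenceFunction φ)
    {x y : Vec J × ℝ × ℝ} (hx : x ∈ dualDomain φ F) (hy : y ∈ dualDomain φ F) {a b : ℝ}
    (ha : 0 < a) (hb : 0 < b) (hab : a + b = 1) :
    dualValue φ ρ F (a • x + b • y) ≤ a * dualValue φ ρ F x + b * dualValue φ ρ F y := by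
  have h := integral_mono (convex_comb_mem_dualDomain hF hφ hx hy ha hb hab).2.2
    ((hx.2.2.const_mul a).add (hy.2.2.const_mul b))
    (dualIntegrand_convex_comb_le hφ hx.2.1 hy.2.1 ha hb hab)
  simp only [Pi.add_apply] at h
  rw [integral_add (hx.2.2.const_mul a) (hy.2.2.const_mul b), integral_const_mul,
    integral_const_mul] at h
  simp only [dualValue, Prod.fst_add, Prod.snd_add, Prod.smul_fst, Prod.smul_snd, smul_eq_mul]
  linarith

/-- A shock at which the dual integrand is strictly convex between two normalised points. -/
lemma exists_dualIntegrand_convex_comb_lt (hφ : IsDivergenceFunction φ)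
    (hφ' : ConjugateRegular φ) {x y : Vec J × ℝ × ℝ} (hx : x ∈ dualDomain φ F)
    (hy : y ∈ dualDomain φ F) (hx0 : x.1 ∈ normalized J) (hy0 : y.1 ∈ normalized J) (hne : x ≠ y)
    {a b : ℝ} (ha : 0 < a) (hb : 0 < b) (hab : a + b = 1) :
    ∃ ε, dualIntegrand φ (a • x + b • y) ε <
      a * dualIntegrand φ x ε + b * dualIntegrand φ y ε := by
  -- If all these pairs agreed, alternative `0`, whose utility is normalised, would identify `m`,
  -- and then each utility would be identified.
  obtain ⟨j, hj⟩ : ∃ j, (x.2.1, x.1 j - x.2.2) ≠ (y.2.1, y.1 j - y.2.2) := by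
    by_contra! h
    have h' : ∀ j, x.2.1 = y.2.1 ∧ x.1 j - x.2.2 = y.1 j - y.2.2 := fun j => by
      simpa using h j
    have h0 := (h' 0).2
    rw [show x.1 0 = 0 from hx0, show y.1 0 = 0 from hy0] at h0
    have hm : x.2.2 = y.2.2 := by linarith
    refine hne (Prod.ext ?_ (Prod.ext (h' 0).1 hm))
    ext j
    have := (h' j).2
    linarith
  obtain ⟨s, hs⟩ := hφ'.exists_scaledConj_strict hφ hx.1 hy.1 hx.2.1 hy.2.1 ha hb hab hj
  classical
  -- With the same best alternative at all three points the maximum is affine along the segment, so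
  -- the comparison is one of perspectives only.
  obtain ⟨ε, hε⟩ := exists_maxUtility_eq_apply {x.1, y.1, a • x.1 + b • y.1} j s
  refine ⟨ε, ?_⟩
  have hex := hε x.1 (by simp)
  have hey := hε y.1 (by simp)
  have hez := hε (a • x.1 + b • y.1) (by simp)
  simp only [dualIntegrand, Prod.fst_add, Prod.snd_add, Prod.smul_fst, Prod.smul_snd,
    smul_eq_mul, hex, hey, hez, PiLp.add_apply, PiLp.smul_apply]
  convert hs using 2
  · have : s = a * s + b * s := by rw [← add_mul, hab, one_mul]
    linarith
  · ring_nf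
  · ring_nf

/-- Equality of the integrals of two ordered integrands gives equality almost everywhere, hence
everywhere, by continuity and full support. This contradicts the strict shock. -/
lemma dualValue_convex_comb_lt (hF : IsNominal F) (hφ : IsDivergenceFunction φ)
    (hφ' : ConjugateRegular φ) {x y : Vec J × ℝ × ℝ} (hx : x ∈ dualDomain φ F)
    (hy : y ∈ dualDomain φ F) (hx0 : x.1 ∈ normalized J) (hy0 : y.1 ∈ normalized J) (hne : x ≠ y)
    {a b : ℝ} (ha : 0 < a) (hb : 0 < b) (hab : a + b = 1) :
    dualValue φ ρ F (a • x + b • y) < a * dualValue φ ρ F x + b * dualValue φ ρ F y := by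
  have := hF.isOpenPosMeasure
  refine lt_of_le_of_ne (dualValue_convex_comb_le hF hφ hx hy ha hb hab) fun heq => ?_
  have hz := convex_comb_mem_dualDomain hF hφ hx hy ha hb hab
  obtain ⟨ε, hε⟩ := exists_dualIntegrand_convex_comb_lt hφ hφ' hx hy hx0 hy0 hne ha hb hab
  have hi := (hx.2.2.const_mul a).add (hy.2.2.const_mul b)
  have hint : ∫ ε, dualIntegrand φ (a • x + b • y) ε ∂F =
      ∫ ε, (a * dualIntegrand φ x ε + b * dualIntegrand φ y ε) ∂F := by
    rw [integral_add (hx.2.2.const_mul a) (hy.2.2.const_mul b), integral_const_mul,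
      integral_const_mul]
    simp only [dualValue, Prod.fst_add, Prod.snd_add, Prod.smul_fst, Prod.smul_snd,
      smul_eq_mul] at heq
    linarith
  have hae := (integral_eq_iff_of_ae_le hz.2.2 hi (Filter.Eventually.of_forall
    (dualIntegrand_convex_comb_le hφ hx.2.1 hy.2.1 ha hb hab))).1 hint
  have hfun := (Continuous.ae_eq_iff_eq F (continuous_dualIntegrand hφ hz.2.1)
    (((continuous_dualIntegrand hφ hx.2.1).const_mul a).add
      ((continuous_dualIntegrand hφ hy.2.1).const_mul b))).1 hae
  exact hε.ne (congrFun hfun ε)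

theorem strictConvexOn_objective (hF : IsNominal F) (hφ : IsDivergenceFunction φ)
    (hφ' : ConjugateRegular φ) (p : Vec J) :
    StrictConvexOn ℝ (feasible J ∩ effDom (objective φ ρ F p))
      (fun x => (objective φ ρ F p x).toReal) := by
  rw [feasible_inter_effDom hF hφ]
  have hc : ∀ ⦃x⦄, x ∈ {x ∈ dualDomain φ F | x.1 ∈ normalized J} → ∀ ⦃y⦄,
      y ∈ {x ∈ dualDomain φ F | x.1 ∈ normalized J} → ∀ ⦃a b : ℝ⦄, 0 < a → 0 < b → a + b = 1 →
      a • x + b • y ∈ {x ∈ dualDomain φ F | x.1 ∈ normalized J} := by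
    intro x hx y hy a b ha hb hab
    refine ⟨convex_comb_mem_dualDomain hF hφ hx.1 hy.1 ha hb hab, ?_⟩
    have h1 : x.1 0 = 0 := hx.2
    have h2 : y.1 0 = 0 := hy.2
    change (a • x + b • y).1 0 = 0
    simp [h1, h2]
  refine ⟨convex_iff_forall_pos.2 hc, fun x hx y hy hne a b ha hb hab => ?_⟩
  have hz := hc hx hy ha hb hab
  have h := dualValue_convex_comb_lt (ρ := ρ) hF hφ hφ' hx.1 hy.1 hx.2 hy.2 hne ha hb hab
  simp only [objective_eq_coe hφ p hx.1, objective_eq_coe hφ p hy.1, objective_eq_coe hφ p hz.1,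
    EReal.toReal_coe, smul_eq_mul, Prod.fst_add, Prod.smul_fst, inner_add_right,
    real_inner_smul_right]
  linarith

end Dual

/-! ### Weak duality -/

lemma expect_coe_eq_bot {Ω : Type*} [MeasurableSpace Ω] {P : Measure Ω} {Y : Ω → ℝ}
    (hm : AEStronglyMeasurable Y P) (hp : ∫⁻ ω, ENNReal.ofReal (Y ω) ∂P ≠ ⊤)
    (hY : ¬ Integrable Y P) : expect P (fun ω => (Y ω : EReal)) = ⊥ := by
  have h : ∫⁻ ω, ENNReal.ofReal (-Y ω) ∂P = ⊤ := by
    by_contra h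
    refine hY ⟨hm, ?_⟩
    have hle : ∫⁻ ω, ‖Y ω‖ₑ ∂P ≤
        ∫⁻ ω, ENNReal.ofReal (Y ω) ∂P + ∫⁻ ω, ENNReal.ofReal (-Y ω) ∂P := by
      rw [← lintegral_add_left' hm.aemeasurable.ennreal_ofReal]
      refine lintegral_mono fun ω => ?_
      rw [Real.enorm_eq_ofReal_abs]
      rcases le_total 0 (Y ω) with h0 | h0
      · rw [abs_of_nonneg h0]; exact le_self_add
      · rw [abs_of_nonpos h0]; exact le_add_self
    exact lt_of_le_of_lt hle (ENNReal.add_lt_top.2 ⟨lt_top_iff_ne_top.2 hp, lt_top_iff_ne_top.2 h⟩)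
  simp only [expect, ← EReal.coe_neg, EReal.real_coe_toENNReal, h]
  simp

section WeakDuality

variable {J : ℕ} {F : Measure (Vec J)} {φ : ℝ → EReal} {ρ : ℝ}

lemma cost_rnDeriv (hφ : IsDivergenceFunction φ) (hρ : 0 < ρ) {G : Measure (Vec J)}
    (hG : G ∈ uncertaintySet φ ρ F) :
    (∀ᵐ ε ∂F, (G.rnDeriv F ε).toReal ∈ effDom φ) ∧
      Integrable (fun ε => cost φ (G.rnDeriv F ε).toReal) F ∧
      ∫ ε, cost φ (G.rnDeriv F ε).toReal ∂F ≤ ρ := by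
  obtain ⟨-, hac, hd⟩ := hG
  rw [divergence, if_pos hac] at hd
  have hne : ∫⁻ ε, (φ (G.rnDeriv F ε).toReal).toENNReal ∂F ≠ ⊤ :=
    ne_top_of_le_ne_top ENNReal.ofReal_ne_top hd
  have hm : Measurable fun ε => (φ (G.rnDeriv F ε).toReal).toENNReal :=
    (hφ.measurable.comp (Measure.measurable_rnDeriv G F).ennreal_toReal).ereal_toENNReal
  have hc : ∀ t, cost φ t = ((φ t).toENNReal).toReal := fun t =>
    (EReal.toReal_toENNReal (hφ.nonneg t)).symm
  refine ⟨?_, ?_, ?_⟩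
  · filter_upwards [ae_lt_top hm hne] with ε hε
    rw [mem_effDom_iff, lt_top_iff_ne_top]
    exact EReal.toENNReal_ne_top_iff.1 hε.ne
  · simp only [hc]
    exact integrable_toReal_of_lintegral_ne_top hm.aemeasurable hne
  · simp only [hc]
    rw [integral_toReal hm.aemeasurable (ae_lt_top hm hne)]
    exact ENNReal.toReal_le_of_le_ofReal hρ.le hd

/-- Fenchel–Young at the density: `g (H - m) ≤ (l φ)*(H - m) + l φ(g)`. Integrating and using mass
one and divergence at most `ρ` gives the bound. -/
theorem surplus_le_dualValue (hF : IsNominal F) (hφ : IsDivergenceFunction φ) (hρ : 0 < ρ)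
    {x : Vec J × ℝ × ℝ} (hx : x ∈ dualDomain φ F) :
    surplus φ ρ F x.1 ≤ (dualValue φ ρ F x : EReal) := by
  have := hF.prob
  refine iSup₂_le fun G hG => ?_
  obtain ⟨hdom, hci, hcρ⟩ := cost_rnDeriv hφ hρ hG
  have hGp : IsProbabilityMeasure G := hG.1
  have hac := hG.2.1
  obtain ⟨hl, hf, hi⟩ := hx
  let g : Vec J → ℝ := fun ε => (G.rnDeriv F ε).toReal
  have hgi : Integrable g F := Measure.integrable_toReal_rnDeriv
  have hg1 : ∫ ε, g ε ∂F = 1 := by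
    rw [Measure.integral_toReal_rnDeriv hac]; simp
  have hci2 : Integrable (fun ε => x.2.1 * cost φ (g ε)) F := hci.const_mul _
  have hi2 : Integrable (fun ε => dualIntegrand φ x ε + x.2.1 * cost φ (g ε)) F := hi.add hci2
  have hUi : Integrable (fun ε => dualIntegrand φ x ε + x.2.1 * cost φ (g ε) + x.2.2 * g ε) F :=
    hi2.add (hgi.const_mul _)
  have hle : ∀ᵐ ε ∂F, g ε * maxUtility x.1 ε ≤
      dualIntegrand φ x ε + x.2.1 * cost φ (g ε) + x.2.2 * g ε := by
    filter_upwards [hdom] with ε hε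
    have := tilt_le_scaledConj hf (y := maxUtility x.1 ε - x.2.2) ⟨g ε, hε⟩
    simp only [tilt] at this
    simp only [dualIntegrand]
    linarith
  have hL : G.HaveLebesgueDecomposition F := Measure.haveLebesgueDecomposition_of_sigmaFinite G F
  by_cases hI : Integrable (maxUtility x.1) G
  · rw [expect_coe_of_integrable hI, EReal.coe_le_coe_iff, ← integral_rnDeriv_smul hac]
    have hI' := (integrable_rnDeriv_smul_iff hac).2 hI
    refine (integral_mono_ae hI' hUi hle).trans ?_
    have h1 : ∫ ε, (dualIntegrand φ x ε + x.2.1 * cost φ (g ε) + x.2.2 * g ε) ∂F =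
        ∫ ε, dualIntegrand φ x ε ∂F + x.2.1 * ∫ ε, cost φ (g ε) ∂F + x.2.2 * ∫ ε, g ε ∂F := by
      rw [integral_add hi2 (hgi.const_mul _), integral_add hi hci2, integral_const_mul,
        integral_const_mul]
    rw [h1, hg1, dualValue]
    have := mul_le_mul_of_nonneg_left hcρ hl
    linarith
  -- The same pointwise bound makes the positive part integrable under `G`, so a non-integrable
  -- utility has expectation `⊥`.
  · rw [expect_coe_eq_bot (continuous_maxUtility _).aestronglyMeasurable _ hI]
    · exact bot_le
    · rw [← lintegral_rnDeriv_mul hac (continuous_maxUtility _).measurable.ennreal_ofReal.aemeasurable]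
      refine ne_top_of_le_ne_top hUi.lintegral_lt_top.ne (lintegral_mono_ae ?_)
      filter_upwards [hle, Measure.rnDeriv_lt_top G F] with ε hε hlt
      rw [← ENNReal.ofReal_toReal hlt.ne, ← ENNReal.ofReal_mul ENNReal.toReal_nonneg]
      exact ENNReal.ofReal_le_ofReal hε

end WeakDuality

/-! ### Bounded densities -/

section Density

variable {J : ℕ} {F : Measure (Vec J)} {φ : ℝ → EReal} {ρ : ℝ}

/-- Bounded measurable functions with values in the effective domain of `φ` along which `φ` is
bounded. -/
structure BoundedDensity (φ : ℝ → EReal) (g : Vec J → ℝ) : Prop where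
  measurable : Measurable g
  mem : ∀ ε, g ε ∈ effDom φ
  bound : ∃ C, ∀ ε, g ε ≤ C
  cost_bound : ∃ C, ∀ ε, cost φ (g ε) ≤ C

namespace BoundedDensity

variable {g h : Vec J → ℝ}

lemma const {t : ℝ} (ht : t ∈ effDom φ) : BoundedDensity φ (fun _ : Vec J => t) :=
  ⟨measurable_const, fun _ => ht, ⟨t, fun _ => le_rfl⟩, ⟨cost φ t, fun _ => le_rfl⟩⟩

open Classical in
lemma ite (hg : BoundedDensity φ g) (hh : BoundedDensity φ h) {s : Set (Vec J)}
    (hs : MeasurableSet s) : BoundedDensity φ (fun ε => if ε ∈ s then g ε else h ε) := by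
  obtain ⟨C, hC⟩ := hg.bound
  obtain ⟨D, hD⟩ := hh.bound
  obtain ⟨C', hC'⟩ := hg.cost_bound
  obtain ⟨D', hD'⟩ := hh.cost_bound
  refine ⟨Measurable.ite hs hg.measurable hh.measurable, fun ε => ?_, ⟨max C D, fun ε => ?_⟩,
    ⟨max C' D', fun ε => ?_⟩⟩
  · split_ifs
    exacts [hg.mem ε, hh.mem ε]
  · split_ifs
    exacts [(hC ε).trans (le_max_left _ _), (hD ε).trans (le_max_right _ _)]
  · split_ifs
    exacts [(hC' ε).trans (le_max_left _ _), (hD' ε).trans (le_max_right _ _)]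

lemma convex_comb (hφ : IsDivergenceFunction φ) (hg : BoundedDensity φ g)
    (hh : BoundedDensity φ h) {a b : ℝ} (ha : 0 ≤ a) (hb : 0 ≤ b) (hab : a + b = 1) :
    BoundedDensity φ (fun ε => a * g ε + b * h ε) := by
  obtain ⟨C, hC⟩ := hg.bound
  obtain ⟨D, hD⟩ := hh.bound
  obtain ⟨C', hC'⟩ := hg.cost_bound
  obtain ⟨D', hD'⟩ := hh.cost_bound
  have hc := fun ε => hφ.convex_comb (hg.mem ε) (hh.mem ε) ha hb hab
  exact ⟨(hg.measurable.const_mul a).add (hh.measurable.const_mul b), fun ε => (hc ε).1,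
    ⟨a * C + b * D, fun ε => add_le_add (mul_le_mul_of_nonneg_left (hC ε) ha)
      (mul_le_mul_of_nonneg_left (hD ε) hb)⟩,
    ⟨a * C' + b * D', fun ε => (hc ε).2.trans (add_le_add (mul_le_mul_of_nonneg_left (hC' ε) ha)
      (mul_le_mul_of_nonneg_left (hD' ε) hb))⟩⟩

lemma nonneg (hφ : IsDivergenceFunction φ) (hg : BoundedDensity φ g) (ε : Vec J) : 0 ≤ g ε :=
  hφ.nonneg_of_mem (hg.mem ε)

lemma integrable (hF : IsNominal F) (hφ : IsDivergenceFunction φ) (hg : BoundedDensity φ g) :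
    Integrable g F := by
  have := hF.prob
  obtain ⟨C, hC⟩ := hg.bound
  refine (integrable_const C).mono' hg.measurable.aestronglyMeasurable
    (Filter.Eventually.of_forall fun ε => ?_)
  rw [Real.norm_of_nonneg (hg.nonneg hφ ε)]
  exact hC ε

lemma integrable_cost (hF : IsNominal F) (hφ : IsDivergenceFunction φ)
    (hg : BoundedDensity φ g) : Integrable (fun ε => cost φ (g ε)) F := by
  have := hF.prob
  obtain ⟨C, hC⟩ := hg.cost_bound
  refine (integrable_const C).mono'
    (hφ.measurable_cost.comp hg.measurable).aestronglyMeasurable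
    (Filter.Eventually.of_forall fun ε => ?_)
  rw [Real.norm_of_nonneg (hφ.cost_nonneg _)]
  exact hC ε

lemma integrable_mul_maxUtility (hF : IsNominal F) (hφ : IsDivergenceFunction φ)
    (hg : BoundedDensity φ g) (u : Vec J) : Integrable (fun ε => g ε * maxUtility u ε) F := by
  obtain ⟨C, hC⟩ := hg.bound
  refine (integrable_maxUtility hF u).bdd_mul (c := C) hg.measurable.aestronglyMeasurable
    (Filter.Eventually.of_forall fun ε => ?_)
  rw [Real.norm_of_nonneg (hg.nonneg hφ ε)]
  exact hC ε

/-- A bounded density of mass one and divergence at most `ρ` bounds the surplus from below. -/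
lemma le_surplus (hF : IsNominal F) (hφ : IsDivergenceFunction φ) (hg : BoundedDensity φ g)
    (h1 : ∫ ε, g ε ∂F = 1) (hρ : ∫ ε, cost φ (g ε) ∂F ≤ ρ) (u : Vec J) :
    ((∫ ε, g ε * maxUtility u ε ∂F : ℝ) : EReal) ≤ surplus φ ρ F u := by
  have := hF.prob
  have hmg : Measurable fun ε => ENNReal.ofReal (g ε) := hg.measurable.ennreal_ofReal
  have hfin : ∀ᵐ ε ∂F, ENNReal.ofReal (g ε) < ⊤ :=
    Filter.Eventually.of_forall fun _ => ENNReal.ofReal_lt_top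
  have htr : ∀ ε, (ENNReal.ofReal (g ε)).toReal = g ε := fun ε =>
    ENNReal.toReal_ofReal (hg.nonneg hφ ε)
  let G : Measure (Vec J) := F.withDensity fun ε => ENNReal.ofReal (g ε)
  have hac : G ≪ F := withDensity_absolutelyContinuous F _
  have hprob : IsProbabilityMeasure G := ⟨by
    rw [withDensity_apply _ MeasurableSet.univ, Measure.restrict_univ,
      ← ofReal_integral_eq_lintegral_ofReal (hg.integrable hF hφ)
        (Filter.Eventually.of_forall fun ε => hg.nonneg hφ ε), h1, ENNReal.ofReal_one]⟩
  have hG : G ∈ uncertaintySet φ ρ F := by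
    refine ⟨hprob, hac, ?_⟩
    rw [divergence, if_pos hac]
    have hrn : G.rnDeriv F =ᵐ[F] fun ε => ENNReal.ofReal (g ε) :=
      Measure.rnDeriv_withDensity₀ F hmg.aemeasurable
    have : ∫⁻ ε, (φ (G.rnDeriv F ε).toReal).toENNReal ∂F =
        ∫⁻ ε, ENNReal.ofReal (cost φ (g ε)) ∂F := by
      refine lintegral_congr_ae ?_
      filter_upwards [hrn] with ε hε
      rw [hε, htr, ← EReal.real_coe_toENNReal, hφ.coe_cost (hg.mem ε)]
    rw [this, ← ofReal_integral_eq_lintegral_ofReal (hg.integrable_cost hF hφ)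
        (Filter.Eventually.of_forall fun ε => hφ.cost_nonneg _)]
    exact ENNReal.ofReal_le_ofReal hρ
  have hI : Integrable (maxUtility u) G := by
    rw [integrable_withDensity_iff hmg hfin]
    simpa only [htr, mul_comm] using hg.integrable_mul_maxUtility hF hφ u
  refine le_trans (le_of_eq ?_) (le_iSup₂ (f := fun G (_ : G ∈ uncertaintySet φ ρ F) =>
    expect G (fun ε => (maxUtility u ε : EReal))) G hG)
  rw [expect_coe_of_integrable hI, integral_withDensity_eq_integral_toReal_smul hmg hfin]
  simp only [htr, smul_eq_mul]

end BoundedDensity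

/-- The nominal distribution itself is feasible, so the surplus is never `⊥`. -/
lemma integral_maxUtility_le_surplus (hF : IsNominal F) (hφ : IsDivergenceFunction φ)
    (hρ : 0 < ρ) (u : Vec J) :
    ((∫ ε, maxUtility u ε ∂F : ℝ) : EReal) ≤ surplus φ ρ F u := by
  have := hF.prob
  have h := (BoundedDensity.const (J := J) hφ.one_mem_effDom).le_surplus (ρ := ρ) hF hφ (by simp)
    (by simpa [hφ.cost_one] using hρ.le) u
  simpa using h

end Density

/-! ### Strong duality with attained multipliers -/

section StrongDuality

variable {J : ℕ} {F : Measure (Vec J)} {φ : ℝ → EReal} {ρ : ℝ}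

/-- Triples (upper bound of the divergence, mass, lower bound of the expected utility) of bounded
densities. -/
def attainable (φ : ℝ → EReal) (F : Measure (Vec J)) (u : Vec J) : Set (ℝ × ℝ × ℝ) :=
  {z | ∃ g, BoundedDensity φ g ∧ ∫ ε, cost φ (g ε) ∂F ≤ z.1 ∧ ∫ ε, g ε ∂F = z.2.1 ∧
    z.2.2 ≤ ∫ ε, g ε * maxUtility u ε ∂F}

lemma const_mem_attainable (hF : IsNominal F) (u : Vec J) {t r w : ℝ} (ht : t ∈ effDom φ)
    (hr : cost φ t ≤ r) (hw : w ≤ t * ∫ ε, maxUtility u ε ∂F) :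
    (r, t, w) ∈ attainable φ F u := by
  have := hF.prob
  refine ⟨_, BoundedDensity.const ht, ?_, ?_, ?_⟩
  · simpa using hr
  · simp
  · simpa [integral_const_mul] using hw

lemma convex_attainable (hF : IsNominal F) (hφ : IsDivergenceFunction φ) (u : Vec J) :
    Convex ℝ (attainable φ F u) := by
  rintro x ⟨g, hg, hg1, hg2, hg3⟩ y ⟨h, hh, hh1, hh2, hh3⟩ a b ha hb hab
  have hz := hg.convex_comb hφ hh ha hb hab
  refine ⟨_, hz, ?_, ?_, ?_⟩
  · have h1 := integral_mono (hz.integrable_cost hF hφ)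
      (((hg.integrable_cost hF hφ).const_mul a).add ((hh.integrable_cost hF hφ).const_mul b))
      (fun ε => (hφ.convex_comb (hg.mem ε) (hh.mem ε) ha hb hab).2)
    simp only [Pi.add_apply] at h1
    rw [integral_add ((hg.integrable_cost hF hφ).const_mul a)
      ((hh.integrable_cost hF hφ).const_mul b), integral_const_mul, integral_const_mul] at h1
    have h2 := mul_le_mul_of_nonneg_left hg1 ha
    have h3 := mul_le_mul_of_nonneg_left hh1 hb
    simp only [Prod.fst_add, Prod.smul_fst, smul_eq_mul]
    linarith
  · rw [integral_add ((hg.integrable hF hφ).const_mul a) ((hh.integrable hF hφ).const_mul b),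
      integral_const_mul, integral_const_mul, hg2, hh2]
    simp
  · have e : ∀ ε, (a * g ε + b * h ε) * maxUtility u ε =
        a * (g ε * maxUtility u ε) + b * (h ε * maxUtility u ε) := fun ε => by ring
    simp only [e]
    rw [integral_add ((hg.integrable_mul_maxUtility hF hφ u).const_mul a)
      ((hh.integrable_mul_maxUtility hF hφ u).const_mul b), integral_const_mul, integral_const_mul]
    have h2 := mul_le_mul_of_nonneg_left hg3 ha
    have h3 := mul_le_mul_of_nonneg_left hh3 hb
    simp only [Prod.snd_add, Prod.smul_snd, smul_eq_mul]
    linarith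

/-- Convexity bounds `cost` on an interval about `1` by its values at the two ends. -/
lemma IsDivergenceFunction.exists_Icc_bound (hφ : IsDivergenceFunction φ) :
    ∃ η R, 0 < η ∧ 0 ≤ R ∧ ∀ t, |t - 1| ≤ η → t ∈ effDom φ ∧ cost φ t ≤ R := by
  obtain ⟨δ, hδ, hball⟩ := Metric.mem_nhds_iff.1 (mem_interior_iff_mem_nhds.1 hφ.one_mem)
  have h1 : 1 - δ / 2 ∈ effDom φ := hball (by
    rw [Metric.mem_ball, Real.dist_eq, abs_lt]; constructor <;> linarith)
  have h2 : 1 + δ / 2 ∈ effDom φ := hball (by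
    rw [Metric.mem_ball, Real.dist_eq, abs_lt]; constructor <;> linarith)
  refine ⟨δ / 2, cost φ (1 - δ / 2) + cost φ (1 + δ / 2), by positivity,
    add_nonneg (hφ.cost_nonneg _) (hφ.cost_nonneg _), fun t ht => ?_⟩
  obtain ⟨ht1, ht2⟩ := abs_le.1 ht
  have ha : 0 ≤ (1 + δ / 2 - t) / δ := div_nonneg (by linarith) hδ.le
  have hb : 0 ≤ (t - 1 + δ / 2) / δ := div_nonneg (by linarith) hδ.le
  have hab : (1 + δ / 2 - t) / δ + (t - 1 + δ / 2) / δ = 1 := by field_simp; ring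
  have h := hφ.convex_comb h1 h2 ha hb hab
  have he : (1 + δ / 2 - t) / δ * (1 - δ / 2) + (t - 1 + δ / 2) / δ * (1 + δ / 2) = t := by
    field_simp; ring
  rw [he] at h
  refine ⟨h.1, h.2.trans (add_le_add ?_ ?_)⟩
  · exact mul_le_of_le_one_left (hφ.cost_nonneg _) (by linarith)
  · exact mul_le_of_le_one_left (hφ.cost_nonneg _) (by linarith)

/-- Constant densities near `1` vary the mass in both directions; the slack allowed in the other two
coordinates fills out an open set. -/
lemma interior_attainable_nonempty (hF : IsNominal F) (hφ : IsDivergenceFunction φ) (u : Vec J) :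
    (interior (attainable φ F u)).Nonempty := by
  obtain ⟨η, R, hη, -, hR⟩ := hφ.exists_Icc_bound
  let B := ∫ ε, maxUtility u ε ∂F
  let O : Set (ℝ × ℝ × ℝ) := {z | R < z.1} ∩ ({z | |z.2.1 - 1| < η} ∩ {z | z.2.2 < z.2.1 * B})
  have hO : IsOpen O := by
    refine IsOpen.inter (isOpen_lt ?_ ?_) (IsOpen.inter (isOpen_lt ?_ ?_) (isOpen_lt ?_ ?_)) <;>
      fun_prop
  refine ⟨(R + 1, 1, B - 1), interior_mono (s := O) ?_ (hO.interior_eq.symm ▸ ?_)⟩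
  · rintro ⟨r, t, w⟩ ⟨h1, h2, h3⟩
    have h1' : R < r := h1
    have h2' : |t - 1| < η := h2
    have h3' : w < t * B := h3
    have := hR t h2'.le
    exact const_mem_attainable hF u this.1 (this.2.trans h1'.le) h3'.le
  · refine ⟨?_, ?_, ?_⟩
    · change R < R + 1; linarith
    · change |(1 : ℝ) - 1| < η; simpa using hη
    · change B - 1 < 1 * B; linarith

/-- Lagrange multipliers for the divergence and mass constraints. -/
lemma exists_multipliers (hF : IsNominal F) (hφ : IsDivergenceFunction φ) (hρ : 0 < ρ)
    {u : Vec J} {w : ℝ} (hw : surplus φ ρ F u ≤ (w : EReal)) :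
    ∃ l m : ℝ, 0 ≤ l ∧ ∀ g, BoundedDensity φ g →
      ∫ ε, g ε * maxUtility u ε ∂F - l * ∫ ε, cost φ (g ε) ∂F - m * ∫ ε, g ε ∂F ≤
        w - l * ρ - m := by
  -- Near an interior point some `(ρ, 1, w + δ)` with `δ > 0` would be attained, giving a feasible
  -- density with expected utility above `w`.
  have hnot : (ρ, 1, w) ∉ interior (attainable φ F u) := by
    intro hint
    have hc : Continuous fun δ : ℝ => ((ρ, 1, w + δ) : ℝ × ℝ × ℝ) := by fun_prop
    have hnh : ∀ᶠ δ in 𝓝 (0 : ℝ), ((ρ, 1, w + δ) : ℝ × ℝ × ℝ) ∈ attainable φ F u := by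
      refine hc.continuousAt.eventually_mem ?_
      rw [add_zero]
      exact mem_interior_iff_mem_nhds.1 hint
    obtain ⟨r, hr, hball⟩ := Metric.eventually_nhds_iff.1 hnh
    obtain ⟨g, hg, h1, h2, h3⟩ := hball (y := r / 2) (by
      rw [Real.dist_eq, sub_zero, abs_of_pos (by positivity)]; linarith)
    have h4 := EReal.coe_le_coe_iff.1 ((hg.le_surplus hF hφ h2 h1 u).trans hw)
    dsimp only at h3
    linarith
  obtain ⟨f, hf0, hf⟩ := geometric_hahn_banach_of_nonempty_interior_point
    (convex_attainable hF hφ u) hnot (interior_attainable_nonempty hF hφ u)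
  obtain ⟨η, R, hη, hR0, hR⟩ := hφ.exists_Icc_bound
  obtain ⟨α, hα⟩ : ∃ α, f (1, 0, 0) = α := ⟨_, rfl⟩
  obtain ⟨β, hβ⟩ : ∃ β, f (0, 1, 0) = β := ⟨_, rfl⟩
  obtain ⟨γ, hγ⟩ : ∃ γ, f (0, 0, 1) = γ := ⟨_, rfl⟩
  have hrep : ∀ r m v : ℝ, f (r, m, v) = α * r + β * m + γ * v := fun r m v => by
    have : ((r, m, v) : ℝ × ℝ × ℝ) = r • (1, 0, 0) + m • (0, 1, 0) + v • (0, 0, 1) := by simp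
    rw [this, map_add, map_add, map_smul, map_smul, map_smul, hα, hβ, hγ]
    simp only [smul_eq_mul]; ring
  have hf' : ∀ r m v : ℝ, (r, m, v) ∈ attainable φ F u →
      α * r + β * m + γ * v ≤ α * ρ + β * 1 + γ * w := fun r m v h => by
    have := hf _ h
    rwa [hrep, hrep] at this
  let B := ∫ ε, maxUtility u ε ∂F
  -- Divergence bounds can be raised at will; for `α > 0` the chosen one is nonnegative and violates
  -- the separation inequality.
  have hα0 : α ≤ 0 := by
    by_contra! h
    have := hf' ((α * ρ + γ * w - γ * B) / α + 1 + |(α * ρ + γ * w - γ * B) / α + 1|) 1 B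
      (const_mem_attainable hF u hφ.one_mem_effDom
        (by rw [hφ.cost_one]; linarith [neg_abs_le ((α * ρ + γ * w - γ * B) / α + 1)]) (by simp [B]))
    have h2 : α * ((α * ρ + γ * w - γ * B) / α + 1 + |(α * ρ + γ * w - γ * B) / α + 1|) ≥
        α * ρ + γ * w - γ * B + α := by
      have : α * ((α * ρ + γ * w - γ * B) / α) = α * ρ + γ * w - γ * B := by field_simp
      have := mul_nonneg h.le (abs_nonneg ((α * ρ + γ * w - γ * B) / α + 1))
      linarith
    linarith
  have hγ0 : 0 ≤ γ := by
    by_contra! h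
    have := hf' ρ 1 (min B (w - 1)) (const_mem_attainable hF u hφ.one_mem_effDom
      (by rw [hφ.cost_one]; exact hρ.le) (by simp [B]))
    have h2 := mul_lt_mul_of_neg_left (lt_of_le_of_lt (min_le_right B (w - 1)) (sub_one_lt w)) h
    linarith
  have hγpos : 0 < γ := by
    -- Slater's condition. If `γ = 0`, the density `1`, whose divergence is `0 < ρ`, forces `α = 0`;
    -- the constant densities `1 ± η` then force `β = 0`.
    refine hγ0.lt_of_ne fun h => hf0 ?_
    have hγz : γ = 0 := h.symm
    have e1 := hf' 0 1 B (const_mem_attainable hF u hφ.one_mem_effDom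
      (by rw [hφ.cost_one]) (by simp [B]))
    have hαz : α = 0 := by
      rw [hγz] at e1
      nlinarith
    have e2 := hf' R (1 + η) ((1 + η) * B) (const_mem_attainable hF u
      (hR (1 + η) (by simp [abs_of_pos hη])).1 (hR (1 + η) (by simp [abs_of_pos hη])).2 le_rfl)
    have e3 := hf' R (1 - η) ((1 - η) * B) (const_mem_attainable hF u
      (hR (1 - η) (by simp [abs_of_pos hη])).1 (hR (1 - η) (by simp [abs_of_pos hη])).2 le_rfl)
    rw [hγz, hαz] at e2 e3
    have hβz : β = 0 := by
      have h1 : β * η ≤ 0 := by linarith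
      have h2 : 0 ≤ β * η := by linarith
      have : β * η = 0 := le_antisymm h1 h2
      exact (mul_eq_zero.1 this).resolve_right hη.ne'
    refine ContinuousLinearMap.ext fun z => ?_
    have := hrep z.1 z.2.1 z.2.2
    rw [hαz, hβz, hγz] at this
    simpa using this
  refine ⟨-α / γ, -β / γ, div_nonneg (neg_nonneg.2 hα0) hγ0, fun g hg => ?_⟩
  have := hf' _ _ _ ⟨g, hg, le_rfl, rfl, le_rfl⟩
  have e1 : γ * (∫ ε, g ε * maxUtility u ε ∂F - -α / γ * ∫ ε, cost φ (g ε) ∂F -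
      -β / γ * ∫ ε, g ε ∂F) = α * ∫ ε, cost φ (g ε) ∂F + β * ∫ ε, g ε ∂F +
      γ * ∫ ε, g ε * maxUtility u ε ∂F := by field_simp; ring
  have e2 : γ * (w - -α / γ * ρ - -β / γ) = α * ρ + β * 1 + γ * w := by field_simp; ring
  refine le_of_mul_le_mul_left ?_ hγpos
  rw [e1, e2]
  exact this

/-! ### Interchange of supremum and expectation -/

/-- A sequence in the effective domain along which the graph of `φ` is dense. -/
lemma exists_seq_tilt_dense (hφ : IsDivergenceFunction φ) :
    ∃ τ : ℕ → effDom φ, ∀ l y (t : effDom φ) δ, 0 < δ → ∃ n, tilt φ l y t - δ < tilt φ l y (τ n) := by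
  -- Density is taken in the graph, where the tilt is a continuous function of the point, so
  -- continuity of `φ` is not needed.
  let Γ : Set (ℝ × ℝ) := Set.range fun t : effDom φ => ((t : ℝ), cost φ t)
  have := hφ.nonempty
  have hne : Nonempty Γ := (Set.range_nonempty _).to_subtype
  obtain ⟨s, hs⟩ := TopologicalSpace.exists_dense_seq Γ
  choose τ hτ using fun n => (s n).2
  refine ⟨τ, fun l y t δ hδ => ?_⟩
  let O : Set Γ := {z | tilt φ l y t - δ < z.1.1 * y - l * z.1.2}
  have hO : IsOpen O := isOpen_lt continuous_const (by fun_prop)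
  have hne : O.Nonempty := ⟨⟨_, t, rfl⟩, by
    change tilt φ l y t - δ < (t : ℝ) * y - l * cost φ t
    unfold tilt; linarith⟩
  obtain ⟨n, hn⟩ := hs.exists_mem_open hO hne
  refine ⟨n, ?_⟩
  have hn' : tilt φ l y t - δ < (s n).1.1 * y - l * (s n).1.2 := hn
  rw [← hτ n] at hn'
  exact hn'

/-- The value `g Y - l φ(g)` of a density. -/
noncomputable def tiltFun (φ : ℝ → EReal) (l : ℝ) (Y g : Vec J → ℝ) (ε : Vec J) : ℝ :=
  g ε * Y ε - l * cost φ (g ε)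

/-- Greedy construction: start from `0` and at step `n` switch to `τ n` wherever this gives a larger
tilt. The values become running maxima, and each density takes finitely many values, hence is
bounded. -/
lemma exists_boundedDensity_seq (hφ : IsDivergenceFunction φ) (τ : ℕ → effDom φ) (l : ℝ)
    {Y : Vec J → ℝ} (hY : Measurable Y) :
    ∃ g : ℕ → Vec J → ℝ, (∀ n, BoundedDensity φ (g n)) ∧ (g 0 = fun _ => 0) ∧
      (∀ n ε, tiltFun φ l Y (g n) ε ≤ tiltFun φ l Y (g (n + 1)) ε) ∧
      ∀ n ε, tilt φ l (Y ε) (τ n) ≤ tiltFun φ l Y (g (n + 1)) ε := by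
  classical
  let S : ℕ → (Vec J → ℝ) → Set (Vec J) := fun n h =>
    {ε | tilt φ l (Y ε) (τ n) ≤ tiltFun φ l Y h ε}
  let g : ℕ → Vec J → ℝ := fun n => Nat.rec (fun _ => 0)
    (fun n h ε => if ε ∈ S n h then h ε else τ n) n
  have hsucc : ∀ n ε, g (n + 1) ε = if ε ∈ S n (g n) then g n ε else τ n := fun _ _ => rfl
  have hval : ∀ n ε, tiltFun φ l Y (g (n + 1)) ε =
      max (tiltFun φ l Y (g n) ε) (tilt φ l (Y ε) (τ n)) := fun n ε => by
    unfold tiltFun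
    rw [hsucc]
    split_ifs with h
    · exact (max_eq_left h).symm
    · exact (max_eq_right (not_le.1 h).le).symm
  have hB : ∀ n, BoundedDensity φ (g n) := fun n => by
    induction n with
    | zero => exact BoundedDensity.const hφ.zero_mem_effDom
    | succ n ih =>
      refine ih.ite (BoundedDensity.const (τ n).2) (measurableSet_le ?_ ?_)
      · unfold tilt; fun_prop
      · exact (ih.measurable.mul hY).sub
          ((hφ.measurable_cost.comp ih.measurable).const_mul l)
  exact ⟨g, hB, rfl, fun n ε => (hval n ε).symm ▸ le_max_left _ _,
    fun n ε => (hval n ε).symm ▸ le_max_right _ _⟩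

/-- A bound for the penalised expected utility of bounded densities is a bound for the integral of
the conjugate. -/
lemma mem_dualDomain_of_forall_le (hF : IsNominal F) (hφ : IsDivergenceFunction φ)
    {u : Vec J} {l m C : ℝ} (hl : 0 ≤ l)
    (h : ∀ g, BoundedDensity φ g →
      ∫ ε, g ε * maxUtility u ε ∂F - l * ∫ ε, cost φ (g ε) ∂F - m * ∫ ε, g ε ∂F ≤ C) :
    (u, l, m) ∈ dualDomain φ F ∧ ∫ ε, dualIntegrand φ (u, l, m) ε ∂F ≤ C := by
  have := hF.prob
  let Y : Vec J → ℝ := fun ε => maxUtility u ε - m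
  have hYc : Continuous Y := (continuous_maxUtility u).sub continuous_const
  -- The sequence starts at the density `0`, of value `-c`, so adding `c` makes all values
  -- nonnegative and monotone convergence applies.
  let c := l * cost φ 0
  obtain ⟨τ, hτ⟩ := exists_seq_tilt_dense hφ
  obtain ⟨g, hg, hg0, hmono, hge⟩ := exists_boundedDensity_seq hφ τ l hYc.measurable
  let v : ℕ → Vec J → ℝ := fun n => tiltFun φ l Y (g n)
  have hvm : ∀ ε, Monotone fun n => v n ε := fun ε => monotone_nat_of_le_succ fun n => hmono n ε
  have hv0 : ∀ n ε, 0 ≤ v n ε + c := fun n ε => by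
    have := hvm ε (Nat.zero_le n)
    simp only [v, tiltFun, hg0, zero_mul, zero_sub] at this
    simp only [v, tiltFun, c]
    linarith
  have hveq : ∀ n ε, v n ε = g n ε * maxUtility u ε - l * cost φ (g n ε) - m * g n ε :=
    fun n ε => by simp only [v, tiltFun, Y]; ring
  have hvi : ∀ n, Integrable (v n) F ∧ ∫ ε, v n ε ∂F ≤ C := fun n => by
    have i1 := (hg n).integrable_mul_maxUtility hF hφ u
    have i2 := ((hg n).integrable_cost hF hφ).const_mul l
    have i3 := ((hg n).integrable hF hφ).const_mul m
    have i12 : Integrable (fun ε => g n ε * maxUtility u ε - l * cost φ (g n ε)) F := i1.sub i2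
    refine ⟨(i12.sub i3).congr (Filter.Eventually.of_forall fun ε => (hveq n ε).symm), ?_⟩
    simp only [hveq]
    rw [integral_sub i12 i3, integral_sub i1 i2, integral_const_mul, integral_const_mul]
    exact h _ (hg n)
  let V : Vec J → ℝ≥0∞ := fun ε => ⨆ n, ENNReal.ofReal (v n ε + c)
  have hV : ∫⁻ ε, V ε ∂F ≤ ENNReal.ofReal (C + c) := by
    have hmeas : ∀ n, Measurable fun ε => ENNReal.ofReal (v n ε + c) := fun n =>
      ((((hg n).measurable.mul hYc.measurable).sub
        ((hφ.measurable_cost.comp (hg n).measurable).const_mul l)).add_const c).ennreal_ofReal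
    rw [lintegral_iSup hmeas fun i j hij ε => ENNReal.ofReal_le_ofReal (by
      have := hvm ε hij
      dsimp only at this; linarith)]
    refine iSup_le fun n => ?_
    rw [← ofReal_integral_eq_lintegral_ofReal (f := fun ε => v n ε + c)
      ((hvi n).1.add (integrable_const c))
      (Filter.Eventually.of_forall (hv0 n)), integral_add (hvi n).1 (integrable_const c)]
    refine ENNReal.ofReal_le_ofReal ?_
    simpa using (hvi n).2
  have htV : ∀ ε (t : effDom φ), ENNReal.ofReal (tilt φ l (Y ε) t + c) ≤ V ε := fun ε t => by
    refine ENNReal.le_of_forall_pos_le_add fun δ hδ _ => ?_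
    obtain ⟨n, hn⟩ := hτ l (Y ε) t δ hδ
    calc ENNReal.ofReal (tilt φ l (Y ε) t + c)
        ≤ ENNReal.ofReal ((v (n + 1) ε + c) + δ) := by
          refine ENNReal.ofReal_le_ofReal ?_
          have := hge n ε
          simp only [v]; linarith
      _ ≤ ENNReal.ofReal (v (n + 1) ε + c) + ENNReal.ofReal δ := ENNReal.ofReal_add_le
      _ ≤ V ε + δ := by
          refine add_le_add (le_iSup (fun n => ENNReal.ofReal (v n ε + c)) (n + 1)) ?_
          simp
  -- If the conjugate were infinite somewhere, `V` would have infinite integral.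
  have hfin : ScaledFinite φ l := by
    by_contra hnf
    have h1 := lintegral_iSup_tilt_eq_top hF hφ hnf hYc fun d => by
      obtain ⟨ε, hε⟩ := exists_lt_maxUtility u (d + m)
      exact ⟨ε, by simp only [Y]; linarith⟩
    have h2 : ∫⁻ ε, (⨆ t : effDom φ, (tilt φ l (Y ε) t : EReal)).toENNReal ∂F ≤
        ∫⁻ ε, V ε ∂F := by
      refine lintegral_mono fun ε => ?_
      rw [← EReal.toENNReal_coe (x := V ε)]
      refine EReal.toENNReal_le_toENNReal (iSup_le fun t => ?_)
      refine le_trans ?_ (EReal.coe_ennreal_le_coe_ennreal_iff.2 (htV ε t))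
      rw [EReal.coe_ennreal_ofReal, EReal.coe_le_coe_iff]
      refine le_trans ?_ (le_max_left _ _)
      have : 0 ≤ c := mul_nonneg hl (hφ.cost_nonneg 0)
      linarith
    rw [h1] at h2
    exact absurd (h2.trans hV) (by simp)
  have hk : ∀ ε, ENNReal.ofReal (dualIntegrand φ (u, l, m) ε + c) ≤ V ε := fun ε => by
    have := hφ.nonempty
    by_cases hVt : V ε = ⊤
    · rw [hVt]; exact le_top
    · refine ENNReal.ofReal_le_of_le_toReal ?_
      have : dualIntegrand φ (u, l, m) ε ≤ (V ε).toReal - c := scaledConj_le hφ fun t => by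
        have := (ENNReal.ofReal_le_iff_le_toReal hVt).1 (htV ε t)
        simp only [Y] at this
        linarith
      linarith
  have hcont := continuous_dualIntegrand hφ (x := (u, l, m)) hfin
  have hpos : ∀ ε, 0 ≤ dualIntegrand φ (u, l, m) ε + c := fun ε => by
    have := neg_le_dualIntegrand hφ (x := (u, l, m)) hfin ε
    simp only [c]; linarith
  have hlt : ∫⁻ ε, ENNReal.ofReal (dualIntegrand φ (u, l, m) ε + c) ∂F ≤ ENNReal.ofReal (C + c) :=
    (lintegral_mono hk).trans hV
  have hi' : Integrable (fun ε => dualIntegrand φ (u, l, m) ε + c) F := by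
    refine ⟨(hcont.add continuous_const).aestronglyMeasurable, ?_⟩
    rw [hasFiniteIntegral_iff_ofReal (Filter.Eventually.of_forall hpos)]
    exact hlt.trans_lt ENNReal.ofReal_lt_top
  have hi : Integrable (dualIntegrand φ (u, l, m)) F := by
    refine (hi'.sub (integrable_const c)).congr (Filter.Eventually.of_forall fun ε => ?_)
    simp
  refine ⟨⟨hl, hfin, hi⟩, ?_⟩
  rw [← ofReal_integral_eq_lintegral_ofReal hi' (Filter.Eventually.of_forall hpos),
    integral_add hi (integrable_const c)] at hlt
  -- `ENNReal.ofReal` truncates at zero, so the sign is needed to return to real numbers; testing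
  -- the hypothesis with the density `0` supplies it.
  have hCc : 0 ≤ C + c := by
    have h0 := h _ (hg 0)
    have : 0 ≤ c := mul_nonneg hl (hφ.cost_nonneg 0)
    simp only [hg0, zero_mul, integral_zero, mul_zero, integral_const, probReal_univ, one_smul,
      sub_zero] at h0
    simp only [c]; linarith
  have := (ENNReal.ofReal_le_ofReal_iff hCc).1 hlt
  simp only [integral_const, probReal_univ, one_smul] at this
  linarith

theorem exists_dualValue_le (hF : IsNominal F) (hφ : IsDivergenceFunction φ) (hρ : 0 < ρ)
    {u : Vec J} {w : ℝ} (hw : surplus φ ρ F u ≤ (w : EReal)) :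
    ∃ l m : ℝ, (u, l, m) ∈ dualDomain φ F ∧ dualValue φ ρ F (u, l, m) ≤ w := by
  obtain ⟨l, m, hl, h⟩ := exists_multipliers hF hφ hρ hw
  obtain ⟨h1, h2⟩ := mem_dualDomain_of_forall_le hF hφ hl h
  refine ⟨l, m, h1, ?_⟩
  simp only [dualValue]
  linarith

end StrongDuality

/-! ### The surplus as a finite, convex, Lipschitz function -/

section SurplusReal

variable {J : ℕ} {F : Measure (Vec J)} {φ : ℝ → EReal} {ρ : ℝ}

/-- The finite values of the robust surplus. -/
noncomputable def surplusReal (φ : ℝ → EReal) (ρ : ℝ) (F : Measure (Vec J)) (u : Vec J) : ℝ :=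
  (surplus φ ρ F u).toReal

/-- Raising `m` by `c` offsets any rise of the utilities by at most `c`. Hence finiteness does not
depend on `u`, and the surplus is Lipschitz. -/
lemma shift_mem_dualDomain (hF : IsNominal F) (hφ : IsDivergenceFunction φ) {u v : Vec J}
    {l m c : ℝ} (hx : (u, l, m) ∈ dualDomain φ F) (h : ∀ j, v j ≤ u j + c) :
    (v, l, m + c) ∈ dualDomain φ F ∧
      dualValue φ ρ F (v, l, m + c) ≤ dualValue φ ρ F (u, l, m) + c := by
  have hle : ∀ ε, dualIntegrand φ (v, l, m + c) ε ≤ dualIntegrand φ (u, l, m) ε := fun ε =>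
    scaledConj_mono hφ hx.2.1 (by
      have := maxUtility_le_add h ε
      dsimp only; linarith)
  have hi := integrable_dualIntegrand_of_le hF hφ (x := (v, l, m + c)) hx.2.1 hx.2.2 hle
  refine ⟨⟨hx.1, hx.2.1, hi⟩, ?_⟩
  have := integral_mono hi hx.2.2 hle
  simp only [dualValue]
  linarith

lemma exists_mem_dualDomain (hF : IsNominal F) (hφ : IsDivergenceFunction φ)
    (hne : (dualDomain φ F).Nonempty) (u : Vec J) :
    ∃ l m : ℝ, (u, l, m) ∈ dualDomain φ F := by
  obtain ⟨⟨v, l, m⟩, hx⟩ := hne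
  refine ⟨l, m + ‖u - v‖, (shift_mem_dualDomain (ρ := 0) hF hφ hx fun j => ?_).1⟩
  have := (le_abs_self _).trans (abs_apply_le_norm (u - v) j)
  rw [PiLp.sub_apply] at this
  linarith

/-- A finite surplus would, by strong duality, produce a dual point of finite value. -/
lemma surplus_eq_top (hF : IsNominal F) (hφ : IsDivergenceFunction φ) (hρ : 0 < ρ)
    (hne : ¬ (dualDomain φ F).Nonempty) (u : Vec J) : surplus φ ρ F u = ⊤ := by
  by_contra h
  refine hne ?_
  obtain ⟨l, m, hx, -⟩ := exists_dualValue_le hF hφ hρ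
    (EReal.le_coe_toReal h)
  exact ⟨_, hx⟩

lemma coe_surplusReal (hF : IsNominal F) (hφ : IsDivergenceFunction φ) (hρ : 0 < ρ)
    (hne : (dualDomain φ F).Nonempty) (u : Vec J) : (surplusReal φ ρ F u : EReal) = surplus φ ρ F u := by
  obtain ⟨l, m, hx⟩ := exists_mem_dualDomain hF hφ hne u
  have h1 := surplus_le_dualValue hF hφ hρ hx
  have h2 := integral_maxUtility_le_surplus hF hφ hρ u
  exact EReal.coe_toReal (h1.trans_lt (EReal.coe_lt_top _)).ne
    ((EReal.bot_lt_coe _).trans_le h2).ne'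

lemma surplusReal_le_dualValue (hF : IsNominal F) (hφ : IsDivergenceFunction φ) (hρ : 0 < ρ)
    (hne : (dualDomain φ F).Nonempty) {x : Vec J × ℝ × ℝ} (hx : x ∈ dualDomain φ F) :
    surplusReal φ ρ F x.1 ≤ dualValue φ ρ F x := by
  have := surplus_le_dualValue hF hφ hρ hx
  rwa [← coe_surplusReal hF hφ hρ hne, EReal.coe_le_coe_iff] at this

lemma exists_dualValue_eq (hF : IsNominal F) (hφ : IsDivergenceFunction φ) (hρ : 0 < ρ)
    (hne : (dualDomain φ F).Nonempty) (u : Vec J) :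
    ∃ l m : ℝ, (u, l, m) ∈ dualDomain φ F ∧ dualValue φ ρ F (u, l, m) = surplusReal φ ρ F u := by
  obtain ⟨l, m, hx, hle⟩ := exists_dualValue_le hF hφ hρ (coe_surplusReal hF hφ hρ hne u).ge
  have h := surplusReal_le_dualValue hF hφ hρ hne hx
  exact ⟨l, m, hx, le_antisymm hle h⟩

lemma surplusReal_le_add (hF : IsNominal F) (hφ : IsDivergenceFunction φ) (hρ : 0 < ρ)
    (hne : (dualDomain φ F).Nonempty) {u v : Vec J} {c : ℝ} (h : ∀ j, v j ≤ u j + c) :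
    surplusReal φ ρ F v ≤ surplusReal φ ρ F u + c := by
  obtain ⟨l, m, hx, heq⟩ := exists_dualValue_eq hF hφ hρ hne u
  obtain ⟨hm, hle⟩ := shift_mem_dualDomain (ρ := ρ) hF hφ hx h
  rw [← heq]
  exact (surplusReal_le_dualValue hF hφ hρ hne hm).trans hle

lemma continuous_surplusReal (hF : IsNominal F) (hφ : IsDivergenceFunction φ) (hρ : 0 < ρ)
    (hne : (dualDomain φ F).Nonempty) : Continuous (surplusReal φ ρ F) := by
  refine LipschitzWith.continuous (K := 1) (LipschitzWith.of_le_add fun u v => ?_)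
  refine surplusReal_le_add hF hφ hρ hne fun j => ?_
  have := (le_abs_self _).trans (abs_apply_le_norm (u - v) j)
  rw [PiLp.sub_apply] at this
  rw [dist_eq_norm]
  linarith

/-- Partial minimisation of the jointly convex dual value over `(l, m)` preserves convexity. -/
lemma convexOn_surplusReal (hF : IsNominal F) (hφ : IsDivergenceFunction φ) (hρ : 0 < ρ)
    (hne : (dualDomain φ F).Nonempty) : ConvexOn ℝ Set.univ (surplusReal φ ρ F) := by
  rw [convexOn_iff_forall_pos]
  refine ⟨convex_univ, fun u _ v _ a b ha hb hab => ?_⟩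
  obtain ⟨l, m, hx, hxe⟩ := exists_dualValue_eq hF hφ hρ hne u
  obtain ⟨l', m', hy, hye⟩ := exists_dualValue_eq hF hφ hρ hne v
  rw [← hxe, ← hye]
  exact (surplusReal_le_dualValue hF hφ hρ hne
    (convex_comb_mem_dualDomain hF hφ hx hy ha hb hab)).trans
    (dualValue_convex_comb_le hF hφ hx hy ha hb hab)

end SurplusReal

/-! ### Differentiability of the surplus -/

section Differentiability

variable {J : ℕ} {F : Measure (Vec J)} {φ : ℝ → EReal} {ρ : ℝ}

/-- The level set of a nonzero functional is a proper affine subspace, hence Lebesgue null. -/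
lemma measure_linear_eq_const (hF : IsNominal F) {L : Vec J →ₗ[ℝ] ℝ} (hL : L ≠ 0) (c : ℝ) :
    F {ε | L ε = c} = 0 := by
  refine hF.absCont ?_
  let A : AffineSubspace ℝ (Vec J) :=
    { carrier := {ε | L ε = c}
      smul_vsub_vadd_mem' := by
        intro r x y z hx hy hz
        have hx' : L x = c := hx
        have hy' : L y = c := hy
        have hz' : L z = c := hz
        change L (r • (x -ᵥ y) +ᵥ z) = c
        simp [hx', hy', hz'] }
  refine Measure.addHaar_affineSubspace volume A fun hA => hL ?_
  have hall : ∀ ε, L ε = c := fun ε => by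
    have : ε ∈ A := hA ▸ AffineSubspace.mem_top ℝ (Vec J) ε
    exact this
  ext ε
  have h0 := hall 0
  rw [map_zero] at h0
  rw [hall ε, ← h0]; rfl

/-- Ties between two alternatives have probability zero. -/
lemma ae_add_ne_add (hF : IsNominal F) (u : Vec J) {i j : Fin (J + 1)} (hij : i ≠ j) :
    ∀ᵐ ε ∂F, u i + ε i ≠ u j + ε j := by
  let L : Vec J →ₗ[ℝ] ℝ := ((EuclideanSpace.proj i - EuclideanSpace.proj j :
    Vec J →L[ℝ] ℝ) : Vec J →ₗ[ℝ] ℝ)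
  have hL : L ≠ 0 := fun h => by
    have := LinearMap.congr_fun h (EuclideanSpace.single i (1 : ℝ))
    simp [L, hij.symm] at this
  refine measure_mono_null (fun ε hε => ?_) (measure_linear_eq_const hF hL (u j - u i))
  have hε' : u i + ε i = u j + ε j := not_not.1 hε
  change ε i - ε j = u j - u i
  linarith

lemma ae_maxUtility_ne (hF : IsNominal F) (u : Vec J) (m : ℝ) :
    ∀ᵐ ε ∂F, maxUtility u ε ≠ m := by
  have h : ∀ j : Fin (J + 1), ∀ᵐ ε ∂F, u j + ε j ≠ m := fun j => by
    let L : Vec J →ₗ[ℝ] ℝ := ((EuclideanSpace.proj j : Vec J →L[ℝ] ℝ) : Vec J →ₗ[ℝ] ℝ)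
    have hL : L ≠ 0 := fun h => by
      have := LinearMap.congr_fun h (EuclideanSpace.single j (1 : ℝ))
      simp [L] at this
    refine measure_mono_null (fun ε hε => ?_) (measure_linear_eq_const hF hL (m - u j))
    have hε' : u j + ε j = m := not_not.1 hε
    change ε j = m - u j
    linarith
  filter_upwards [ae_all_iff.2 h] with ε hε
  obtain ⟨j, hj⟩ := exists_maxUtility_eq u ε
  rw [hj]
  exact hε j

/-- Almost surely, the best alternative does not change under small changes of the utilities. -/
lemma ae_eventually_maxUtility_add (hF : IsNominal F) (u : Vec J) :
    ∀ᵐ ε ∂F, ∃ j, ∀ᶠ h in 𝓝 (0 : Vec J), maxUtility (u + h) ε = maxUtility u ε + h j := by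
  have hne : ∀ᵐ ε ∂F, ∀ i j : Fin (J + 1), i ≠ j → u i + ε i ≠ u j + ε j := by
    rw [ae_all_iff]; intro i
    rw [ae_all_iff]; intro j
    by_cases hij : i = j
    · simp [hij]
    · simpa [hij] using ae_add_ne_add hF u hij
  filter_upwards [hne] with ε hε
  obtain ⟨j, hj⟩ := exists_maxUtility_eq u ε
  refine ⟨j, ?_⟩
  have hlt : ∀ i, i ≠ j → u i + ε i < u j + ε j := fun i hij =>
    lt_of_le_of_ne (hj ▸ le_maxUtility u ε i) (hε i j hij)
  have hev : ∀ᶠ h in 𝓝 (0 : Vec J), ∀ i, i ≠ j → (u + h) i + ε i ≤ (u + h) j + ε j := by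
    rw [Filter.eventually_all]
    intro i
    by_cases hij : i = j
    · simp [hij]
    · have h1 : Continuous fun h : Vec J => (u + h) i + ε i := by fun_prop
      have h2 : Continuous fun h : Vec J => (u + h) j + ε j := by fun_prop
      have := (h1.tendsto 0).eventually_lt (h2.tendsto 0) (by simpa using hlt i hij)
      filter_upwards [this] with h hh _
      exact hh.le
  filter_upwards [hev] with h hh
  have : maxUtility (u + h) ε = (u + h) j + ε j := by
    refine le_antisymm (maxUtility_le fun i => ?_) (le_maxUtility _ _ _)
    by_cases hij : i = j
    · rw [hij]
    · exact hh i hij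
  rw [this, hj, PiLp.add_apply]
  ring

/-- For `l = 0` the only kink is at `H = m`, an event of probability zero; for `l > 0` the conjugate
is differentiable everywhere. -/
lemma ae_differentiableAt_scaledConj (hF : IsNominal F) (hφ : IsDivergenceFunction φ)
    (hφ' : ConjugateRegular φ) {l : ℝ} (hl : 0 ≤ l) (hf : ScaledFinite φ l) (u : Vec J) (m : ℝ) :
    ∀ᵐ ε ∂F, DifferentiableAt ℝ (scaledConj φ l) (maxUtility u ε - m) := by
  rcases hl.eq_or_lt with rfl | hl
  · obtain ⟨β, -, hβ⟩ := scaledConj_zero_left hφ hf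
    have hfun : scaledConj φ 0 = fun y => β * max y 0 := funext hβ
    filter_upwards [ae_maxUtility_ne hF u m] with ε hε
    rw [hfun]
    refine DifferentiableAt.const_mul ?_ β
    rcases hε.lt_or_gt with h | h
    · refine (differentiableAt_const (0 : ℝ)).congr_of_eventuallyEq ?_
      filter_upwards [Iio_mem_nhds (sub_neg.2 h)] with y hy
      exact max_eq_right (le_of_lt hy)
    · refine differentiableAt_id.congr_of_eventuallyEq ?_
      filter_upwards [Ioi_mem_nhds (sub_pos.2 h)] with y hy
      exact max_eq_left (le_of_lt hy)
  · exact Filter.Eventually.of_forall fun ε => hφ'.differentiable_scaledConj hφ hl hf _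

lemma _root_.DifferentiableAt.isLittleO_second_difference {f : ℝ → ℝ} {y : ℝ}
    (hf : DifferentiableAt ℝ f y) :
    (fun x => f (y + x) + f (y - x) - 2 * f y) =o[𝓝 0] fun x => x := by
  have h1 := hasDerivAt_iff_isLittleO_nhds_zero.1 hf.hasDerivAt
  have ht : Filter.Tendsto (fun x : ℝ => -x) (𝓝 0) (𝓝 0) := by
    simpa using (continuous_neg (G := ℝ)).tendsto 0
  have h2 := (h1.comp_tendsto ht).neg_right
  simp only [Function.comp_def, neg_neg] at h2
  refine (h1.add h2).congr_left fun x => ?_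
  simp only [smul_eq_mul, ← sub_eq_add_neg]
  ring

/-- The difference quotients of the second difference of the dual integrand. -/
noncomputable def secondDifference (φ : ℝ → EReal) (x : Vec J × ℝ × ℝ) (h ε : Vec J) : ℝ :=
  (dualIntegrand φ (x.1 + h, x.2) ε + dualIntegrand φ (x.1 - h, x.2) ε -
    2 * dualIntegrand φ x ε) / ‖h‖

/-- Near `u` the maximum moves by `h j` for one fixed `j`, so this is a one-variable second
difference in `h j`, and `|h j| ≤ ‖h‖`. -/
lemma ae_tendsto_secondDifference (hF : IsNominal F) (hφ : IsDivergenceFunction φ)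
    (hφ' : ConjugateRegular φ) {x : Vec J × ℝ × ℝ} (hx : x ∈ dualDomain φ F) :
    ∀ᵐ ε ∂F, Filter.Tendsto (fun h => secondDifference φ x h ε) (𝓝 0) (𝓝 0) := by
  filter_upwards [ae_eventually_maxUtility_add hF x.1,
    ae_differentiableAt_scaledConj hF hφ hφ' hx.1 hx.2.1 x.1 x.2.2] with ε ⟨j, hj⟩ hd
  have ht : Filter.Tendsto (fun h : Vec J => -h) (𝓝 0) (𝓝 0) := by
    simpa using (continuous_neg (G := Vec J)).tendsto 0
  have htj : Filter.Tendsto (fun h : Vec J => h j) (𝓝 0) (𝓝 0) := by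
    have : Continuous fun h : Vec J => h j := by fun_prop
    simpa using this.tendsto 0
  have hO : (fun h : Vec J => h j) =O[𝓝 0] fun h => ‖h‖ :=
    Asymptotics.IsBigO.of_bound 1 (Filter.Eventually.of_forall fun h => by
      simpa using abs_apply_le_norm h j)
  have ho := ((hd.isLittleO_second_difference).comp_tendsto htj).trans_isBigO hO
  refine (ho.tendsto_div_nhds_zero).congr' ?_
  filter_upwards [hj, ht.eventually hj] with h h1 h2
  simp only [secondDifference, dualIntegrand, sub_eq_add_neg x.1 h, h1, h2, Function.comp_def,
    PiLp.neg_apply]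
  ring_nf

lemma ScaledFinite.of_pos (hφ : IsDivergenceFunction φ) {l δ : ℝ} (hl : 0 ≤ l)
    (hf : ScaledFinite φ l) (hδ : 0 < δ) : ScaledFinite φ δ := by
  rcases hl.eq_or_lt with rfl | hl
  · exact hf.mono hφ hδ.le
  · simpa using (scaledFinite_one_of_pos hl hf).mul hδ

/-- Raising the multiplier in proportion to the change of the utilities keeps the dual integrand
under control. -/
lemma dualIntegrand_add_le (hφ : IsDivergenceFunction φ) {x : Vec J × ℝ × ℝ}
    (hx : x ∈ dualDomain φ F) {δ : ℝ} (hδ : 0 < δ) (h ε : Vec J) :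
    dualIntegrand φ (x.1 + h, x.2.1 + ‖h‖ * δ, x.2.2) ε ≤
      dualIntegrand φ x ε + ‖h‖ * scaledConj φ δ 1 := by
  rcases eq_or_ne h 0 with rfl | hh
  · simp
  · have hpos : 0 < ‖h‖ := norm_pos_iff.2 hh
    have hfδ := (hx.2.1.of_pos hφ hx.1 hδ).mul hpos
    have hf := hx.2.1.mono hφ (l' := x.2.1 + ‖h‖ * δ)
      (le_add_of_nonneg_right (by positivity))
    -- The perturbed pair splits as `(l, y) + ‖h‖ (δ, 1)`.
    have h1 := scaledConj_add_le hφ hx.2.1 hfδ (y := maxUtility x.1 ε - x.2.2) (y' := ‖h‖ * 1)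
    rw [scaledConj_mul _ hpos.le] at h1
    refine le_trans (scaledConj_mono hφ hf ?_) h1
    have := maxUtility_add_le x.1 h ε
    dsimp only
    linarith

lemma dualIntegrand_add_anti (hφ : IsDivergenceFunction φ) {x : Vec J × ℝ × ℝ}
    (hx : x ∈ dualDomain φ F) {c : ℝ} (hc : 0 ≤ c) (v ε : Vec J) :
    dualIntegrand φ (v, x.2.1 + c, x.2.2) ε ≤ dualIntegrand φ (v, x.2) ε :=
  scaledConj_anti hφ hx.2.1 (le_add_of_nonneg_right hc)

/-- If the surplus has a subgradient at a point, it is differentiable there. -/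
theorem hasGradientAt_surplusReal (hF : IsNominal F) (hφ : IsDivergenceFunction φ)
    (hφ' : ConjugateRegular φ) (hρ : 0 < ρ) (hne : (dualDomain φ F).Nonempty) {p u : Vec J}
    (hp : ∀ h, surplusReal φ ρ F u + inner ℝ p h ≤ surplusReal φ ρ F (u + h)) :
    HasGradientAt (surplusReal φ ρ F) p u := by
  have := hF.prob
  obtain ⟨l, m, hx, heq⟩ := exists_dualValue_eq hF hφ hρ hne u
  rw [hasGradientAt_iff_isLittleO_nhds_zero, Asymptotics.isLittleO_iff]
  intro c hc
  -- Raising the multiplier by `‖h‖ δ` in both directions costs `2 δ ρ ‖h‖`, half of the allowed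
  -- error; the integral uses the other half.
  obtain ⟨δ, hδ, hδc⟩ : ∃ δ, 0 < δ ∧ 2 * δ * ρ = c / 2 :=
    ⟨c / (4 * ρ), by positivity, by field_simp; ring⟩
  have hmem : ∀ h, (u + h, l + ‖h‖ * δ, m) ∈ dualDomain φ F := fun h => by
    have hpos : 0 ≤ ‖h‖ * δ := by positivity
    have hf : ScaledFinite φ (l + ‖h‖ * δ) := hx.2.1.mono hφ (le_add_of_nonneg_right hpos)
    exact ⟨add_nonneg hx.1 hpos, hf, integrable_dualIntegrand_of_le hF hφ
      (x := (u + h, l + ‖h‖ * δ, m)) hf (hx.2.2.add (integrable_const _))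
      (dualIntegrand_add_le hφ hx hδ h)⟩
  let K := scaledConj φ δ 1
  -- With `l` unchanged the second difference need not be integrable; the truncation at `2 K`, which
  -- the raised multiplier justifies, provides a dominating constant.
  let b : Vec J → Vec J → ℝ := fun h ε => max 0 (min (2 * K) (secondDifference φ (u, l, m) h ε))
  have hbc : ∀ h, Continuous (b h) := fun h => by
    have c1 := continuous_dualIntegrand hφ (x := (u + h, l, m)) hx.2.1
    have c2 := continuous_dualIntegrand hφ (x := (u - h, l, m)) hx.2.1
    have c3 := continuous_dualIntegrand hφ (x := (u, l, m)) hx.2.1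
    have c4 : Continuous (secondDifference φ (u, l, m) h) :=
      ((c1.add c2).sub (continuous_const.mul c3)).div_const _
    exact continuous_const.max (continuous_const.min c4)
  have hbb : ∀ h ε, ‖b h ε‖ ≤ |2 * K| := fun h ε => by
    rw [Real.norm_of_nonneg (le_max_left _ _)]
    exact max_le (abs_nonneg _) ((min_le_left _ _).trans (le_abs_self _))
  have hbi : ∀ h, Integrable (b h) F := fun h =>
    (integrable_const (|2 * K|)).mono' (hbc h).aestronglyMeasurable
      (Filter.Eventually.of_forall (hbb h))
  have hK : 0 ≤ 2 * K := by
    have h1 : tilt φ δ 1 ⟨1, hφ.one_mem_effDom⟩ ≤ K :=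
      tilt_le_scaledConj (hx.2.1.of_pos hφ hx.1 hδ) _
    simp only [tilt, hφ.cost_one] at h1
    linarith
  have hlim : Filter.Tendsto (fun h => ∫ ε, b h ε ∂F) (𝓝 0) (𝓝 0) := by
    have := tendsto_integral_filter_of_dominated_convergence (μ := F) (l := 𝓝 (0 : Vec J))
      (F := b) (f := fun _ => (0 : ℝ)) (fun _ => |2 * K|)
      (Filter.Eventually.of_forall fun h => (hbc h).aestronglyMeasurable)
      (Filter.Eventually.of_forall fun h => Filter.Eventually.of_forall (hbb h))
      (integrable_const _) (by
        filter_upwards [ae_tendsto_secondDifference hF hφ hφ' hx] with ε hε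
        have h1 : Filter.Tendsto (fun h => b h ε) (𝓝 0) (𝓝 (max 0 (min (2 * K) 0))) :=
          tendsto_const_nhds.max (tendsto_const_nhds.min hε)
        rwa [min_eq_right hK, max_self] at h1)
    simpa using this
  have hint : ∀ h, ∫ ε, dualIntegrand φ (u + h, l + ‖h‖ * δ, m) ε ∂F +
      ∫ ε, dualIntegrand φ (u - h, l + ‖h‖ * δ, m) ε ∂F -
      2 * ∫ ε, dualIntegrand φ (u, l, m) ε ∂F ≤ ‖h‖ * ∫ ε, b h ε ∂F := fun h => by
    have hm1 := (hmem h).2.2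
    have hm2 : Integrable (dualIntegrand φ (u - h, l + ‖h‖ * δ, m)) F := by
      have := (hmem (-h)).2.2
      rwa [norm_neg, ← sub_eq_add_neg] at this
    have i12 : Integrable (fun ε => dualIntegrand φ (u + h, l + ‖h‖ * δ, m) ε +
      dualIntegrand φ (u - h, l + ‖h‖ * δ, m) ε) F := hm1.add hm2
    rw [← integral_add hm1 hm2, ← integral_const_mul, ← integral_sub i12 (hx.2.2.const_mul 2),
      ← integral_const_mul]
    refine integral_mono (i12.sub (hx.2.2.const_mul 2)) ((hbi h).const_mul _) fun ε => ?_
    rcases eq_or_ne h 0 with rfl | hh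
    · simp only [norm_zero, zero_mul, add_zero, sub_zero]
      linarith
    · have hpos : 0 < ‖h‖ := norm_pos_iff.2 hh
      have h1 := dualIntegrand_add_le hφ hx hδ h ε
      have h2 := dualIntegrand_add_le hφ hx hδ (-h) ε
      rw [norm_neg, ← sub_eq_add_neg] at h2
      have h3 := dualIntegrand_add_anti hφ hx (c := ‖h‖ * δ) (by positivity) (u + h) ε
      have h4 := dualIntegrand_add_anti hφ hx (c := ‖h‖ * δ) (by positivity) (u - h) ε
      dsimp only at h1 h2 h3 h4 ⊢
      rw [← div_le_iff₀' hpos]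
      -- The bound `2 K` comes from the control by the raised multiplier, the other from
      -- monotonicity in `l`.
      refine le_trans (le_min ?_ ?_) (le_max_right _ _)
      · rw [div_le_iff₀' hpos]
        change _ ≤ ‖h‖ * (2 * scaledConj φ δ 1)
        linarith
      · exact div_le_div_of_nonneg_right (by linarith) hpos.le
  filter_upwards [(tendsto_order.1 hlim).2 (c / 2) (by positivity)] with h hh
  have hw1 := surplusReal_le_dualValue hF hφ hρ hne (hmem h)
  have hw2 := surplusReal_le_dualValue hF hφ hρ hne (hmem (-h))
  have hp1 := hp h
  have hp2 := hp (-h)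
  have hi := hint h
  rw [inner_neg_right] at hp2
  simp only [dualValue, norm_neg, ← sub_eq_add_neg] at hw1 hw2 hp2 heq
  -- By the subgradient inequality the remainders at `h` and `-h` are both nonnegative, so each is
  -- at most their sum, the second difference of the surplus.
  rw [Real.norm_of_nonneg (by linarith)]
  have h5 : ‖h‖ * ∫ ε, b h ε ∂F ≤ ‖h‖ * (c / 2) := mul_le_mul_of_nonneg_left hh.le (norm_nonneg h)
  have h6 : ‖h‖ * (2 * δ * ρ) = ‖h‖ * (c / 2) := by rw [hδc]
  linarith

end Differentiability

section Inversion

variable {J : ℕ} {F : Measure (Vec J)} {φ : ℝ → EReal} {ρ : ℝ}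

/-! ### The conjugate of the surplus as a minimum of the objective -/

lemma surplusConj_eq_bot (hF : IsNominal F) (hφ : IsDivergenceFunction φ) (hρ : 0 < ρ)
    (hne : ¬ (dualDomain φ F).Nonempty) (p : Vec J) : surplusConj φ ρ F p = ⊥ := by
  simp [surplusConj, surplus_eq_top hF hφ hρ hne]

lemma objective_eq_top_of_empty (hF : IsNominal F) (hφ : IsDivergenceFunction φ)
    (hne : ¬ (dualDomain φ F).Nonempty) (p : Vec J) {x : Vec J × ℝ × ℝ} (hx : x ∈ feasible J) :
    objective φ ρ F p x = ⊤ :=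
  objective_eq_top hF hφ p hx.2 fun h => hne ⟨x, h⟩

lemma surplusConj_eq_iSup (hF : IsNominal F) (hφ : IsDivergenceFunction φ) (hρ : 0 < ρ)
    (hne : (dualDomain φ F).Nonempty) (p : Vec J) :
    surplusConj φ ρ F p =
      ⨆ u ∈ normalized J, ((inner ℝ p u - surplusReal φ ρ F u : ℝ) : EReal) := by
  simp only [surplusConj, ← coe_surplusReal hF hφ hρ hne, EReal.coe_sub]

theorem neg_surplusConj_eq_iInf (hF : IsNominal F) (hφ : IsDivergenceFunction φ) (hρ : 0 < ρ)
    (p : Vec J) :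
    -surplusConj φ ρ F p = ⨅ x ∈ feasible J, objective φ ρ F p x := by
  by_cases hne : (dualDomain φ F).Nonempty
  · rw [surplusConj_eq_iSup hF hφ hρ hne]
    refine le_antisymm (le_iInf₂ fun x hx => ?_) ?_
    · by_cases hxd : x ∈ dualDomain φ F
      · rw [objective_eq_coe hφ p hxd, EReal.neg_le, ← EReal.coe_neg]
        refine le_iSup₂_of_le x.1 hx.1 (EReal.coe_le_coe_iff.2 ?_)
        have := surplusReal_le_dualValue hF hφ hρ hne hxd
        linarith
      · rw [objective_eq_top hF hφ p hx.2 hxd]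
        exact le_top
    · rw [EReal.le_neg]
      refine iSup₂_le fun u hu => ?_
      rw [EReal.le_neg, ← EReal.coe_neg]
      obtain ⟨l, m, hx, heq⟩ := exists_dualValue_eq hF hφ hρ hne u
      refine iInf₂_le_of_le (u, l, m) ⟨hu, hx.1⟩ ?_
      rw [objective_eq_coe hφ p hx, EReal.coe_le_coe_iff, heq]
      dsimp only
      linarith
  · rw [surplusConj_eq_bot hF hφ hρ hne, EReal.neg_bot]
    symm
    rw [iInf_eq_top]
    intro x
    rw [iInf_eq_top]
    exact fun hx => objective_eq_top_of_empty hF hφ hne p hx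

/-! ### Optimal utilities -/

/-- `u` minimises `W^DRO - ⟨p, ·⟩` among the normalised utilities. -/
def IsOptimalUtility (φ : ℝ → EReal) (ρ : ℝ) (F : Measure (Vec J)) (p u : Vec J) : Prop :=
  u ∈ normalized J ∧ ∀ v ∈ normalized J,
    surplusReal φ ρ F u - inner ℝ p u ≤ surplusReal φ ρ F v - inner ℝ p v

lemma exists_isMinOn_objective (hF : IsNominal F) (hφ : IsDivergenceFunction φ) (hρ : 0 < ρ)
    (hne : (dualDomain φ F).Nonempty) {p u : Vec J} (hu : IsOptimalUtility φ ρ F p u) :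
    ∃ l m : ℝ, (u, l, m) ∈ dualDomain φ F ∧
      IsMinOn (objective φ ρ F p) (feasible J) (u, l, m) := by
  obtain ⟨l, m, hx, heq⟩ := exists_dualValue_eq hF hφ hρ hne u
  refine ⟨l, m, hx, isMinOn_iff.2 fun y hy => ?_⟩
  by_cases hyd : y ∈ dualDomain φ F
  · rw [objective_eq_coe hφ p hx, objective_eq_coe hφ p hyd, EReal.coe_le_coe_iff, heq]
    have h1 := surplusReal_le_dualValue hF hφ hρ hne hyd
    have h2 := hu.2 y.1 hy.1
    dsimp only
    linarith
  · rw [objective_eq_top hF hφ p hy.2 hyd]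
    exact le_top

/-- One minimiser has a finite value, so the other does too, and both lie where the objective is
strictly convex. -/
lemma eq_of_isMinOn_objective (hF : IsNominal F) (hφ : IsDivergenceFunction φ)
    (hφ' : ConjugateRegular φ) {p : Vec J} {x y : Vec J × ℝ × ℝ}
    (hx : x ∈ feasible J) (hy : y ∈ feasible J) (hxd : x ∈ dualDomain φ F)
    (hxm : IsMinOn (objective φ ρ F p) (feasible J) x)
    (hym : IsMinOn (objective φ ρ F p) (feasible J) y) : y = x := by
  have hs := strictConvexOn_objective (ρ := ρ) hF hφ hφ' p
  rw [feasible_inter_effDom hF hφ] at hs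
  have hyd : y ∈ dualDomain φ F := by
    by_contra h
    have := isMinOn_iff.1 hym x hx
    rw [objective_eq_top hF hφ p hy.2 h, objective_eq_coe hφ p hxd] at this
    exact absurd this (not_le.2 (EReal.coe_lt_top _))
  have key : ∀ z, z ∈ feasible J → z ∈ dualDomain φ F →
      IsMinOn (objective φ ρ F p) (feasible J) z →
      IsMinOn (fun x => (objective φ ρ F p x).toReal)
        {x ∈ dualDomain φ F | x.1 ∈ normalized J} z := by
    intro z hz hzd hzm
    refine isMinOn_iff.2 fun y hy => ?_
    have := isMinOn_iff.1 hzm y ⟨hy.2, hy.1.1⟩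
    rw [objective_eq_coe hφ p hzd, objective_eq_coe hφ p hy.1] at this
    rw [objective_eq_coe hφ p hzd, objective_eq_coe hφ p hy.1]
    simpa only [EReal.toReal_coe, EReal.coe_le_coe_iff] using this
  exact hs.eq_of_isMinOn (key y hy hyd hym) (key x hx hxd hxm) ⟨hyd, hy.1⟩ ⟨hxd, hx.1⟩

lemma IsOptimalUtility.exists_isUniqueMinimizer (hF : IsNominal F) (hφ : IsDivergenceFunction φ)
    (hφ' : ConjugateRegular φ) (hρ : 0 < ρ) (hne : (dualDomain φ F).Nonempty) {p u : Vec J}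
    (hu : IsOptimalUtility φ ρ F p u) :
    ∃ l m : ℝ, IsUniqueMinimizer (objective φ ρ F p) (feasible J) (u, l, m) := by
  obtain ⟨l, m, hx, hmin⟩ := exists_isMinOn_objective hF hφ hρ hne hu
  have hxf : (u, l, m) ∈ feasible J := ⟨hu.1, hx.1⟩
  exact ⟨l, m, hxf, hmin, fun y hy hym =>
    eq_of_isMinOn_objective hF hφ hφ' hxf hy hx hmin hym⟩

lemma IsOptimalUtility.eq (hF : IsNominal F) (hφ : IsDivergenceFunction φ)
    (hφ' : ConjugateRegular φ) (hρ : 0 < ρ) (hne : (dualDomain φ F).Nonempty) {p u v : Vec J}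
    (hu : IsOptimalUtility φ ρ F p u) (hv : IsOptimalUtility φ ρ F p v) : v = u := by
  obtain ⟨l, m, hx, hmin⟩ := exists_isMinOn_objective hF hφ hρ hne hu
  obtain ⟨l', m', hy, hmin'⟩ := exists_isMinOn_objective hF hφ hρ hne hv
  exact congrArg Prod.fst (eq_of_isMinOn_objective hF hφ hφ' (x := (u, l, m)) (y := (v, l', m'))
    ⟨hu.1, hx.1⟩ ⟨hv.1, hy.1⟩ hx hmin hmin')

lemma isOptimalUtility_of_isMinOn (hF : IsNominal F) (hφ : IsDivergenceFunction φ)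
    (hρ : 0 < ρ) (hne : (dualDomain φ F).Nonempty) {p u : Vec J} {l m : ℝ}
    (hx : (u, l, m) ∈ feasible J) (hmin : IsMinOn (objective φ ρ F p) (feasible J) (u, l, m)) :
    IsOptimalUtility φ ρ F p u := by
  refine ⟨hx.1, fun v hv => ?_⟩
  obtain ⟨l', m', hy, heq⟩ := exists_dualValue_eq hF hφ hρ hne v
  have hle := isMinOn_iff.1 hmin (v, l', m') ⟨hv, hy.1⟩
  rw [objective_eq_coe hφ p hy, heq] at hle
  have hxd : (u, l, m) ∈ dualDomain φ F := by
    by_contra h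
    rw [objective_eq_top hF hφ p hx.2 h] at hle
    exact absurd hle (not_le.2 (EReal.coe_lt_top _))
  rw [objective_eq_coe hφ p hxd, EReal.coe_le_coe_iff] at hle
  have := surplusReal_le_dualValue hF hφ hρ hne hxd
  dsimp only at this hle
  linarith

/-! ### Gradients of the surplus and of its conjugate -/

/-- Adding a constant to all utilities shifts the surplus and `⟨p, ·⟩` equally, as `p` sums to one.
Optimality among normalised utilities thus makes `p` a subgradient on the whole space. -/
lemma IsOptimalUtility.hasGradient_surplus (hF : IsNominal F) (hφ : IsDivergenceFunction φ)
    (hφ' : ConjugateRegular φ) (hρ : 0 < ρ) (hne : (dualDomain φ F).Nonempty) {p u : Vec J}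
    (hp : (fun j => p j) ∈ stdSimplex ℝ (Fin (J + 1))) (hu : IsOptimalUtility φ ρ F p u) :
    HasGradient (surplus φ ρ F) p u := by
  refine ⟨surplusReal φ ρ F, Filter.Eventually.of_forall fun v =>
    (coe_surplusReal hF hφ hρ hne v).symm, hasGradientAt_surplusReal hF hφ hφ' hρ hne fun h => ?_⟩
  let e : Vec J := WithLp.toLp 2 fun _ => 1
  have he : inner ℝ p e = 1 := by
    have : ∑ j, p j = 1 := hp.2
    simpa [e, PiLp.inner_apply] using this
  let c := (u + h) 0
  have h1 := hu.2 (u + h - c • e) (by change (u + h - c • e) 0 = 0; simp [e, c])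
  have h2 : surplusReal φ ρ F (u + h - c • e) ≤ surplusReal φ ρ F (u + h) + -c :=
    surplusReal_le_add hF hφ hρ hne fun j => by simp [e, sub_eq_add_neg]
  rw [inner_sub_right, inner_add_right, inner_smul_right, he] at h1
  linarith

/-- On the segment from `u` to `v` the convex surplus lies above its tangent at `u`. -/
lemma isOptimalUtility_of_hasGradient_surplus (hF : IsNominal F) (hφ : IsDivergenceFunction φ)
    (hρ : 0 < ρ) (hne : (dualDomain φ F).Nonempty) {p u : Vec J}
    (hu : u ∈ normalized J) (h : HasGradient (surplus φ ρ F) p u) :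
    IsOptimalUtility φ ρ F p u := by
  obtain ⟨f', hf', hg⟩ := h
  have heq : surplusReal φ ρ F =ᶠ[𝓝 u] f' := by
    filter_upwards [hf'] with v hv
    rwa [← coe_surplusReal hF hφ hρ hne, EReal.coe_eq_coe_iff] at hv
  have hg' : HasGradientAt (surplusReal φ ρ F) p u := hg.congr_of_eventuallyEq heq
  refine ⟨hu, fun v _ => ?_⟩
  have hc : ConvexOn ℝ Set.univ (surplusReal φ ρ F ∘ AffineMap.lineMap (k := ℝ) u v) :=
    (convexOn_surplusReal hF hφ hρ hne).comp_affineMap (AffineMap.lineMap u v)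
  have hd : HasDerivAt (surplusReal φ ρ F ∘ AffineMap.lineMap (k := ℝ) u v)
      (inner ℝ p (v - u)) 0 := by
    have h1 : HasFDerivAt (surplusReal φ ρ F) (InnerProductSpace.toDual ℝ (Vec J) p)
        (AffineMap.lineMap (k := ℝ) u v 0) := by
      rw [AffineMap.lineMap_apply_zero]; exact hg'.hasFDerivAt
    have h2 := h1.comp_hasDerivAt (0 : ℝ) (AffineMap.hasDerivAt_lineMap (a := u) (b := v))
    simpa using h2
  have := hc.le_slope_of_hasDerivAt (Set.mem_univ 0) (Set.mem_univ 1) one_pos hd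
  simp only [slope_def_field, Function.comp_apply, AffineMap.lineMap_apply_zero,
    AffineMap.lineMap_apply_one, sub_zero, div_one, inner_sub_right] at this
  linarith

lemma le_surplusConj (hF : IsNominal F) (hφ : IsDivergenceFunction φ)
    (hρ : 0 < ρ) (hne : (dualDomain φ F).Nonempty) (p : Vec J) {u : Vec J}
    (hu : u ∈ normalized J) :
    ((inner ℝ p u - surplusReal φ ρ F u : ℝ) : EReal) ≤ surplusConj φ ρ F p := by
  rw [surplusConj_eq_iSup hF hφ hρ hne]
  exact le_iSup₂ (f := fun u (_ : u ∈ normalized J) =>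
    ((inner ℝ p u - surplusReal φ ρ F u : ℝ) : EReal)) u hu

/-- No maximiser is known to exist beforehand. A near-maximiser `v` at `p`, tested at `p + h` with
`h` along `v - u`, must lie close to the gradient `u`; Lipschitz continuity then makes `u` itself
optimal. -/
lemma isOptimalUtility_of_hasGradient_surplusConj (hF : IsNominal F)
    (hφ : IsDivergenceFunction φ) (hρ : 0 < ρ) (hne : (dualDomain φ F).Nonempty) {p u : Vec J}
    (hu : u ∈ normalized J) (h : HasGradient (surplusConj φ ρ F) u p) :
    IsOptimalUtility φ ρ F p u := by
  obtain ⟨f', hf', hg⟩ := h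
  have hle : ∀ v ∈ normalized J, inner ℝ p v - surplusReal φ ρ F v ≤ f' p := fun v hv => by
    have := le_surplusConj hF hφ hρ hne p hv
    rwa [hf'.self_of_nhds, EReal.coe_le_coe_iff] at this
  -- The error is `c` from near-maximality, `2 c` from the Lipschitz bound and `2 c ‖p‖` from the
  -- linear term, since `‖v - u‖ ≤ 2 c`.
  suffices hmain : ∀ c > 0, surplusReal φ ρ F u - inner ℝ p u ≤ -f' p + c * (3 + 2 * ‖p‖) by
    refine ⟨hu, fun v hv => ?_⟩
    have h1 := hle v hv
    suffices surplusReal φ ρ F u - inner ℝ p u ≤ -f' p by linarith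
    refine le_of_forall_pos_le_add fun δ hδ => ?_
    have hpos : 0 < 3 + 2 * ‖p‖ := by positivity
    have := hmain (δ / (3 + 2 * ‖p‖)) (by positivity)
    rwa [div_mul_cancel₀ _ hpos.ne'] at this
  intro c hc
  have ho := hasGradientAt_iff_isLittleO_nhds_zero.1 hg
  have ht : Filter.Tendsto (fun h : Vec J => p + h) (𝓝 0) (𝓝 p) := by
    have : Continuous fun h : Vec J => p + h := by fun_prop
    simpa using this.tendsto 0
  obtain ⟨r, hr, hball⟩ := Metric.eventually_nhds_iff.1
    ((Asymptotics.isLittleO_iff.1 ho hc).and (ht.eventually hf'))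
  obtain ⟨s, hs0, hsr, hs1⟩ : ∃ s, 0 < s ∧ s < r ∧ s ≤ 1 :=
    ⟨min (r / 2) 1, by positivity, (min_le_left _ _).trans_lt (by linarith), min_le_right _ _⟩
  have hlt : ((f' p - c * s : ℝ) : EReal) < surplusConj φ ρ F p := by
    rw [hf'.self_of_nhds, EReal.coe_lt_coe_iff]
    have : 0 < c * s := by positivity
    linarith
  rw [surplusConj_eq_iSup hF hφ hρ hne] at hlt
  simp only [lt_iSup_iff] at hlt
  obtain ⟨v, hv, hvlt⟩ := hlt
  rw [EReal.coe_lt_coe_iff] at hvlt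
  have hdist : ‖v - u‖ ≤ 2 * c := by
    rcases eq_or_ne v u with rfl | hvu
    · simp; linarith
    · have hn : 0 < ‖v - u‖ := norm_pos_iff.2 (sub_ne_zero.2 hvu)
      let h : Vec J := (s / ‖v - u‖) • (v - u)
      have hh : ‖h‖ = s := by
        rw [norm_smul, Real.norm_of_nonneg (by positivity), div_mul_cancel₀ _ hn.ne']
      obtain ⟨hb1, hb2⟩ := hball (y := h) (by rw [dist_zero_right, hh]; exact hsr)
      have h1 := le_surplusConj hF hφ hρ hne (p + h) hv
      rw [hb2, EReal.coe_le_coe_iff, inner_add_left] at h1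
      have h2 := (le_abs_self _).trans hb1
      rw [hh] at h2
      have h3 : inner ℝ h v - inner ℝ u h = s * ‖v - u‖ := by
        rw [real_inner_comm h u, ← inner_sub_right, real_inner_smul_left,
          real_inner_self_eq_norm_sq]
        field_simp
      have h4 : s * ‖v - u‖ ≤ s * (2 * c) := by linarith
      exact le_of_mul_le_mul_left h4 hs0
  have hlip : surplusReal φ ρ F u ≤ surplusReal φ ρ F v + ‖v - u‖ := by
    refine surplusReal_le_add hF hφ hρ hne fun j => ?_
    have := (neg_le_abs _).trans (abs_apply_le_norm (v - u) j)
    rw [PiLp.sub_apply] at this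
    linarith
  have hin : inner ℝ p v - inner ℝ p u ≤ ‖p‖ * (2 * c) := by
    rw [← inner_sub_right]
    exact (real_inner_le_norm _ _).trans (mul_le_mul_of_nonneg_left hdist (norm_nonneg p))
  have : c * s ≤ c := mul_le_of_le_one_right hc.le hs1
  linarith

lemma isClosed_normalized (J : ℕ) : IsClosed (normalized J) := by
  have : Continuous fun u : Vec J => u 0 := by fun_prop
  exact isClosed_eq this continuous_const

/-- Away from the optimal utility, the loss grows at least linearly. -/
lemma IsOptimalUtility.exists_linear_growth (hF : IsNominal F) (hφ : IsDivergenceFunction φ)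
    (hφ' : ConjugateRegular φ) (hρ : 0 < ρ) (hne : (dualDomain φ F).Nonempty) {p u : Vec J}
    (hu : IsOptimalUtility φ ρ F p u) {c : ℝ} (hc : 0 < c) :
    ∃ κ > 0, ∀ v ∈ normalized J, c ≤ ‖v - u‖ →
      surplusReal φ ρ F u - inner ℝ p u + κ * ‖v - u‖ ≤ surplusReal φ ρ F v - inner ℝ p v := by
  let q : Vec J → ℝ := fun v => surplusReal φ ρ F v - inner ℝ p v
  have hq : Continuous q := (continuous_surplusReal hF hφ hρ hne).sub (by fun_prop)
  obtain ⟨κ, hκ, hκq⟩ : ∃ κ > 0, ∀ v ∈ normalized J, ‖v - u‖ = c → q u + κ * c ≤ q v := by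
    have hcomp : IsCompact (Metric.sphere u c ∩ normalized J) :=
      (isCompact_sphere u c).inter_right (isClosed_normalized J)
    -- The sphere misses the normalised utilities when `J = 0`; any constant then serves.
    rcases (Metric.sphere u c ∩ normalized J).eq_empty_or_nonempty with hemp | hnon
    · refine ⟨1, one_pos, fun v hv hvc => ?_⟩
      have : v ∈ Metric.sphere u c ∩ normalized J := ⟨by simpa [dist_eq_norm] using hvc, hv⟩
      rw [hemp] at this
      exact this.elim
    · obtain ⟨z, ⟨hzc, hz⟩, hzmin⟩ := hcomp.exists_isMinOn hnon hq.continuousOn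
      -- Equality would make `z` a second optimal utility, against uniqueness.
      have hzlt : q u < q z := by
        by_contra! h
        have hzo : IsOptimalUtility φ ρ F p z := ⟨hz, fun v hv => h.trans (hu.2 v hv)⟩
        have := hu.eq hF hφ hφ' hρ hne hzo
        rw [this, mem_sphere_iff_norm, sub_self, norm_zero] at hzc
        exact hc.ne hzc
      refine ⟨(q z - q u) / c, div_pos (sub_pos.2 hzlt) hc, fun v hv hvc => ?_⟩
      rw [div_mul_cancel₀ _ hc.ne']
      have : q z ≤ q v := isMinOn_iff.1 hzmin v ⟨by simpa [dist_eq_norm] using hvc, hv⟩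
      linarith
  refine ⟨κ, hκ, fun v hv hvc => ?_⟩
  have hn : 0 < ‖v - u‖ := hc.trans_le hvc
  -- The segment from `u` to `v` meets the sphere at this parameter, and convexity carries the gap
  -- there out to `v`.
  let t := c / ‖v - u‖
  have ht0 : 0 < t := div_pos hc hn
  have ht1 : 0 ≤ 1 - t := sub_nonneg.2 ((div_le_one hn).2 hvc)
  have hz0 : (1 - t) • u + t • v ∈ normalized J := by
    have h1 : u 0 = 0 := hu.1
    have h2 : v 0 = 0 := hv
    change ((1 - t) • u + t • v) 0 = 0
    simp [h1, h2]
  have hzn : ‖(1 - t) • u + t • v - u‖ = c := by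
    have : (1 - t) • u + t • v - u = t • (v - u) := by module
    rw [this, norm_smul, Real.norm_of_nonneg ht0.le, div_mul_cancel₀ _ hn.ne']
  have h1 := hκq _ hz0 hzn
  have h2 := (convexOn_surplusReal hF hφ hρ hne).2 (Set.mem_univ u) (Set.mem_univ v) ht1 ht0.le
    (by ring)
  simp only [q, inner_add_right, real_inner_smul_right] at h1
  simp only [smul_eq_mul] at h2
  have hct : κ * c = t * (κ * ‖v - u‖) := by
    simp only [t]; field_simp
  have h3 : t * (surplusReal φ ρ F u - inner ℝ p u + κ * ‖v - u‖) ≤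
      t * (surplusReal φ ρ F v - inner ℝ p v) := by linarith
  exact le_of_mul_le_mul_left h3 ht0

/-- Testing with `u` bounds the conjugate below by its tangent. Above it, the excess `⟨h, v - u⟩` is
at most `c ‖h‖` for `v` within `c` of `u`, and is absorbed by linear growth for farther `v` once
`‖h‖ < κ`. -/
lemma IsOptimalUtility.hasGradient_surplusConj (hF : IsNominal F) (hφ : IsDivergenceFunction φ)
    (hφ' : ConjugateRegular φ) (hρ : 0 < ρ) (hne : (dualDomain φ F).Nonempty) {p u : Vec J}
    (hu : IsOptimalUtility φ ρ F p u) : HasGradient (surplusConj φ ρ F) u p := by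
  let V := inner ℝ p u - surplusReal φ ρ F u
  have hlow : ∀ h, ((V + inner ℝ u h : ℝ) : EReal) ≤ surplusConj φ ρ F (p + h) := fun h => by
    refine le_trans (le_of_eq ?_) (le_surplusConj hF hφ hρ hne (p + h) hu.1)
    rw [inner_add_left, real_inner_comm h u]
    congr 1
    simp only [V]; ring
  have hup : ∀ c > 0, ∃ κ > 0, ∀ h : Vec J, ‖h‖ < κ →
      surplusConj φ ρ F (p + h) ≤ ((V + inner ℝ u h + c * ‖h‖ : ℝ) : EReal) := fun c hc => by
    obtain ⟨κ, hκ, hgrow⟩ := hu.exists_linear_growth hF hφ hφ' hρ hne hc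
    refine ⟨κ, hκ, fun h hh => ?_⟩
    rw [surplusConj_eq_iSup hF hφ hρ hne]
    refine iSup₂_le fun v hv => EReal.coe_le_coe_iff.2 ?_
    have h1 : inner ℝ h v - inner ℝ u h ≤ ‖h‖ * ‖v - u‖ := by
      rw [real_inner_comm h u, ← inner_sub_right]
      exact real_inner_le_norm _ _
    rw [inner_add_left]
    simp only [V]
    rcases le_or_gt c ‖v - u‖ with hcv | hcv
    · have h2 := hgrow v hv hcv
      have h3 := mul_le_mul_of_nonneg_right hh.le (norm_nonneg (v - u))
      have h4 : 0 ≤ c * ‖h‖ := by positivity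
      linarith
    · have h2 := hu.2 v hv
      have h3 := mul_le_mul_of_nonneg_left hcv.le (norm_nonneg h)
      linarith
  have hcoe : ∀ h c, surplusConj φ ρ F (p + h) ≤ ((V + inner ℝ u h + c * ‖h‖ : ℝ) : EReal) →
      surplusConj φ ρ F (p + h) = ((surplusConj φ ρ F (p + h)).toReal : EReal) := fun h c hle =>
    (EReal.coe_toReal (hle.trans_lt (EReal.coe_lt_top _)).ne
      ((EReal.bot_lt_coe _).trans_le (hlow h)).ne').symm
  have hp0 : surplusConj φ ρ F p = (V : EReal) := by
    obtain ⟨κ, hκ, h⟩ := hup 1 one_pos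
    have h1 := h 0 (by simpa using hκ)
    have h2 := hlow 0
    simp only [add_zero, inner_zero_right, norm_zero, mul_zero] at h1 h2
    exact le_antisymm h1 h2
  refine ⟨fun y => (surplusConj φ ρ F y).toReal, ?_, ?_⟩
  · obtain ⟨κ, hκ, h⟩ := hup 1 one_pos
    refine Metric.eventually_nhds_iff.2 ⟨κ, hκ, fun y hy => ?_⟩
    have := hcoe (y - p) 1 (h _ (by rwa [← dist_eq_norm]))
    rwa [add_sub_cancel] at this
  · rw [hasGradientAt_iff_isLittleO_nhds_zero, Asymptotics.isLittleO_iff]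
    intro c hc
    obtain ⟨κ, hκ, hle⟩ := hup c hc
    refine Metric.eventually_nhds_iff.2 ⟨κ, hκ, fun h hh => ?_⟩
    rw [dist_zero_right] at hh
    have h1 := hlow h
    have h2 := hle h hh
    rw [hcoe h c h2, EReal.coe_le_coe_iff] at h1 h2
    rw [hp0, EReal.toReal_coe, Real.norm_of_nonneg (by linarith)]
    linarith

/-! ### The infinite case -/

lemma not_hasGradient_surplus (hF : IsNominal F) (hφ : IsDivergenceFunction φ) (hρ : 0 < ρ)
    (hne : ¬ (dualDomain φ F).Nonempty) (p u : Vec J) : ¬ HasGradient (surplus φ ρ F) p u := by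
  rintro ⟨f', hf', -⟩
  have := hf'.self_of_nhds
  rw [surplus_eq_top hF hφ hρ hne] at this
  exact EReal.coe_ne_top _ this.symm

lemma not_hasGradient_surplusConj (hF : IsNominal F) (hφ : IsDivergenceFunction φ) (hρ : 0 < ρ)
    (hne : ¬ (dualDomain φ F).Nonempty) (p u : Vec J) :
    ¬ HasGradient (surplusConj φ ρ F) u p := by
  rintro ⟨f', hf', -⟩
  have := hf'.self_of_nhds
  rw [surplusConj_eq_bot hF hφ hρ hne] at this
  exact EReal.coe_ne_bot _ this.symm

lemma not_isUniqueMinimizer (hF : IsNominal F) (hφ : IsDivergenceFunction φ)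
    (hne : ¬ (dualDomain φ F).Nonempty) (p u : Vec J) (l m : ℝ) :
    ¬ IsUniqueMinimizer (objective φ ρ F p) (feasible J) (u, l, m) := by
  rintro ⟨hx, -, huniq⟩
  -- The objective is constantly `⊤`, so every feasible point is a minimiser.
  have hy : (u, l, m + 1) ∈ feasible J := hx
  have := huniq (u, l, m + 1) hy (isMinOn_iff.2 fun z hz => by
    rw [objective_eq_top_of_empty hF hφ hne p hz]; exact le_top)
  simp at this

theorem tfae_hasGradient (hF : IsNominal F) (hφ : IsDivergenceFunction φ)
    (hφ' : ConjugateRegular φ) (hρ : 0 < ρ) {p u : Vec J}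
    (hp : (fun j => p j) ∈ stdSimplex ℝ (Fin (J + 1))) (hu : u ∈ normalized J) :
    [HasGradient (surplus φ ρ F) p u, HasGradient (surplusConj φ ρ F) u p,
      ∃ l m : ℝ, IsUniqueMinimizer (objective φ ρ F p) (feasible J) (u, l, m)].TFAE := by
  by_cases hne : (dualDomain φ F).Nonempty
  · have h1 : HasGradient (surplus φ ρ F) p u ↔ IsOptimalUtility φ ρ F p u :=
      ⟨isOptimalUtility_of_hasGradient_surplus hF hφ hρ hne hu,
        fun h => h.hasGradient_surplus hF hφ hφ' hρ hne hp⟩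
    have h2 : HasGradient (surplusConj φ ρ F) u p ↔ IsOptimalUtility φ ρ F p u :=
      ⟨isOptimalUtility_of_hasGradient_surplusConj hF hφ hρ hne hu,
        fun h => h.hasGradient_surplusConj hF hφ hφ' hρ hne⟩
    have h3 : (∃ l m : ℝ, IsUniqueMinimizer (objective φ ρ F p) (feasible J) (u, l, m)) ↔
        IsOptimalUtility φ ρ F p u :=
      ⟨fun ⟨_, _, hx, hmin, _⟩ => isOptimalUtility_of_isMinOn hF hφ hρ hne hx hmin,
        fun h => h.exists_isUniqueMinimizer hF hφ hφ' hρ hne⟩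
    tfae_have 1 ↔ 2 := h1.trans h2.symm
    tfae_have 2 ↔ 3 := h2.trans h3.symm
    tfae_finish
  · have h1 := not_hasGradient_surplus hF hφ hρ hne p u
    have h2 := not_hasGradient_surplusConj hF hφ hρ hne p u
    have h3 : ¬ ∃ l m : ℝ, IsUniqueMinimizer (objective φ ρ F p) (feasible J) (u, l, m) :=
      fun ⟨l, m, h⟩ => not_isUniqueMinimizer hF hφ hne p u l m h
    tfae_have 1 ↔ 2 := iff_of_false h1 h2
    tfae_have 2 ↔ 3 := iff_of_false h2 h3
    tfae_finish

end Inversion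

end DRORUM

theorem mainTheorem3 (J : ℕ) (F : MeasureTheory.Measure (DRORUM.Vec J))
    (hF : DRORUM.IsNominal F) (φ : ℝ → EReal) (hφ : DRORUM.IsDivergenceFunction φ)
    (hφ' : DRORUM.ConjugateRegular φ) (ρ : ℝ) (hρ : 0 < ρ)
    (p : DRORUM.Vec J) (hp : (fun j => p j) ∈ stdSimplex ℝ (Fin (J + 1))) :
    StrictConvexOn ℝ (DRORUM.feasible J ∩ DRORUM.effDom (DRORUM.objective φ ρ F p))
        (fun x => (DRORUM.objective φ ρ F p x).toReal) ∧
      -DRORUM.surplusConj φ ρ F p = ⨅ x ∈ DRORUM.feasible J, DRORUM.objective φ ρ F p x ∧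
      ∀ u ∈ DRORUM.normalized J,
        [DRORUM.HasGradient (DRORUM.surplus φ ρ F) p u,
          DRORUM.HasGradient (DRORUM.surplusConj φ ρ F) u p,
          ∃ l m : ℝ, DRORUM.IsUniqueMinimizer (DRORUM.objective φ ρ F p) (DRORUM.feasible J)
            (u, l, m)].TFAE :=
  ⟨DRORUM.strictConvexOn_objective hF hφ hφ' p, DRORUM.neg_surplusConj_eq_iInf hF hφ hρ p,
    fun _ hu => DRORUM.tfae_hasGradient hF hφ hφ' hρ hp hu⟩
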